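/- Let $K$ be a field and let $v > d \ge 1$ be integers with $d$ even. Let $C(v,d) \subset \mathbb{R}^d$ be the cyclic polytope, i.e. the convex hull of any $v$ distinct points on the moment curve $\{(x, x^2, \dots, x^d) : x \in \mathbb{R}\}$; it is a simplicial polytope, and its boundary complex $\Delta(C(v,d))$ is the simplicial complex on its $v$ vertices whose faces are the vertex sets of its proper faces. Let $S = K[x_1,\dots,x_v]$ and let $I = I_{\Delta(C(v,d))} \subset S$ be the Stanley--Reisner ideal, generated by the squarefree monomials $\prod_{i \in F} x_i$ with $F \notin \Delta(C(v,d))$. Let $p$ be the projective dimension of $I$ and $\beta_i(I) = \dim_K \operatorname{Tor}_i^S(I,K)$ its $i$-th total Betti number. Then the Betti sequence $(\beta_0(I), \beta_1(I), \dots, \beta_p(I))$ is the $f$-vector of a simplicial complex: there is a finite simplicial complex $\Gamma$ of dimension $p$ which has, for every $0 \le i \le p$, exactly $\beta_i(I)$ faces of dimension $i$. -/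

import Mathlib

open CategoryTheory

universe u

/-! ### Simplicial complexes and their `f`-vectors

A simplicial complex is Mathlib's `PreAbstractSimplicialComplex ι`: a set of nonempty finite
subsets of `ι`, closed under passing to nonempty subsets (points of `ι` need not be vertices).
The empty face is not recorded. -/

/-- `faceCount Γ i` is the number of `i`-dimensional faces (faces with `i + 1` elements). -/
noncomputable def faceCount {ι : Type*} [Finite ι] (Γ : PreAbstractSimplicialComplex ι)
    (i : ℕ) : ℕ :=
  {s : Finset ι | s ∈ Γ.faces ∧ s.card = i + 1}.ncard

/-- `Γ` has dimension `p`: the largest dimension of a face is `p`. -/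
def HasDimension {ι : Type*} (Γ : PreAbstractSimplicialComplex ι) (p : ℕ) : Prop :=
  IsGreatest {k : ℕ | ∃ s ∈ Γ.faces, s.card = k + 1} p

/-- `f = (f 0, …, f p)` is the `f`-vector of `Γ`: the dimension of `Γ` is `p`, and `f i` is the
number of `i`-dimensional faces for each `0 ≤ i ≤ p`. -/
def IsFVector {ι : Type*} [Finite ι] (Γ : PreAbstractSimplicialComplex ι) {p : ℕ}
    (f : Fin (p + 1) → ℕ) : Prop :=
  HasDimension Γ p ∧ ∀ i : Fin (p + 1), f i = faceCount Γ i

/-! ### Cyclic polytopes and boundary complexes -/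

/-- The moment curve `x ↦ (x, x ^ 2, …, x ^ d)` in `ℝ ^ d`. -/
def momentCurve (d : ℕ) (x : ℝ) : Fin d → ℝ := fun k => x ^ ((k : ℕ) + 1)

/-- The polytope spanned by a finite family of points. -/
def polytope {ι E : Type*} [AddCommGroup E] [Module ℝ E] (p : ι → E) : Set E :=
  convexHull ℝ (Set.range p)

/-- A proper face of a polytope `P`: an exposed face (the set of maximizers on `P` of a linear
functional, or the empty set) different from `P`. -/
def IsProperFace {E : Type*} [AddCommGroup E] [Module ℝ E] [TopologicalSpace E]
    (P Φ : Set E) : Prop :=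
  IsExposed ℝ P Φ ∧ Φ ≠ P

/-- The boundary complex of the simplicial polytope with vertices `p i`, as a simplicial complex on
the labels `i`: its faces are the nonempty sets of vertices lying in a common proper face. (In a
simplicial polytope every set of vertices of a proper face spans a face, so these are
exactly the vertex sets of the nonempty proper faces.) -/
def boundaryComplex {ι E : Type*} [AddCommGroup E] [Module ℝ E] [TopologicalSpace E]
    (p : ι → E) : PreAbstractSimplicialComplex ι where
  faces := {F | F.Nonempty ∧ ∃ Φ : Set E, IsProperFace (polytope p) Φ ∧ ∀ i ∈ F, p i ∈ Φ}
  isRelLowerSet_faces := by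
    rintro F ⟨hF, Φ, hΦ, h⟩
    exact ⟨hF, fun G hGF hG => ⟨hG, Φ, hΦ, fun i hi => h i (hGF hi)⟩⟩

/-- The boundary complex of the cyclic polytope `C(v, d)`, the convex hull of the `v` points on the
moment curve in `ℝ ^ d` with parameters `t 0, …, t (v - 1)` (which have to be distinct). -/
def cyclicBoundaryComplex {v : ℕ} (d : ℕ) (t : Fin v → ℝ) :
    PreAbstractSimplicialComplex (Fin v) :=
  boundaryComplex fun i => momentCurve d (t i)

/-! ### Stanley–Reisner ideals and Betti sequences -/

/-- The Stanley–Reisner ideal in `K[x_i : i ∈ ι]`: generated by the squarefree monomials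
`∏ i ∈ F, x_i` over the nonempty sets `F` that are not faces. -/
noncomputable def stanleyReisnerIdeal (K : Type u) [Field K] {ι : Type} (Δ : PreAbstractSimplicialComplex ι) :
    Ideal (MvPolynomial ι K) :=
  Ideal.span {m | ∃ F : Finset ι, F.Nonempty ∧ F ∉ Δ.faces ∧ m = ∏ i ∈ F, MvPolynomial.X i}

/-- The ideal of `K[x_i : i ∈ ι]` generated by the variables. -/
noncomputable def variablesIdeal (K : Type u) [Field K] (ι : Type) : Ideal (MvPolynomial ι K) :=
  Ideal.span (Set.range MvPolynomial.X)

/-- The module `Tor_i^S(I, K)` over `S = K[x_j : j ∈ ι]`, with `K = S / (x_j : j ∈ ι)`. -/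
noncomputable def torResidue {K : Type u} [Field K] {ι : Type}
    (I : Ideal (MvPolynomial ι K)) (i : ℕ) : ModuleCat.{u} (MvPolynomial ι K) :=
  ((Tor (ModuleCat.{u} (MvPolynomial ι K)) i).obj (ModuleCat.of _ I)).obj
    (ModuleCat.of _ (MvPolynomial ι K ⧸ variablesIdeal K ι))

/-- The `i`-th total Betti number `β_i(I) = dim_K Tor_i^S(I, K)` of a homogeneous ideal
`I ⊆ S = K[x_j : j ∈ ι]`, i.e. the rank of the `i`-th module in a minimal graded free resolution
of `I`. (It is finite for finite `ι`.) -/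
noncomputable def bettiNumber {K : Type u} [Field K] {ι : Type} [Finite ι]
    (I : Ideal (MvPolynomial ι K)) (i : ℕ) : ℕ :=
  Module.finrank K
    ((ModuleCat.restrictScalars (algebraMap K (MvPolynomial ι K))).obj (torResidue I i))

/-- `β = (β 0, …, β p)` is the Betti sequence of the homogeneous ideal `I`: `p` is the projective
dimension of `I`, and `β i` is the `i`-th total Betti number for each `0 ≤ i ≤ p`. -/
def IsBettiSequence {K : Type u} [Field K] {ι : Type} [Finite ι]
    (I : Ideal (MvPolynomial ι K)) {p : ℕ} (β : Fin (p + 1) → ℕ) : Prop :=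
  projectiveDimension (ModuleCat.of (MvPolynomial ι K) I) = (p : ℕ∞) ∧
    ∀ i : Fin (p + 1), β i = bettiNumber I i

/-! Write `d = 2m` with `m ≥ 1` and order the vertices by their parameters. A set of vertices lies
in a proper face exactly when some nonzero polynomial of degree at most `d` is nonnegative at all
parameters and vanishes on the set. A Gale-type argument turns this into combinatorics
(`notMem_faces_cyclicBoundaryComplex_iff`): nonfaces are the sets with `m + 1` pairwise
nonconsecutive positions that also have `m` such positions avoiding both ends. So `I` is a
`cyclicIdeal`.

Removing the last of `n + 1` vertices gives `I_{n+1} = A + x_n B` and `A ∩ B = I_n`, where `A` and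
`B` are generated by separated sets of sizes `m + 1` and `m` (`cyclicIdeal_succ`,
`separatedIdeal_inf`). As `x_n` is a nonzerodivisor modulo `A`, there are exact sequences `0 → A →
I_{n+1} → I_{n+1}/A → 0` and `0 → I_n → B → I_{n+1}/A → 0`. Linearity of the resolutions of `A` and
`B`, with the degrees of their generators, makes `Tor(A) → Tor(I_{n+1})` injective and `Tor(I_n) →
Tor(B)` zero. Hence `β(I_{n+1})` is `β(A) + β(B)` plus the shift of `β(I_n)`
(`HasBetti.sup_span_mul`). The same splitting shows that separated ideals have the Betti numbers of
powers of `(x_1, …, x_c)` (`separatedIdeal_resolution`). No grading is used: linearity is replaced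
by `DetectedByHead`.

Betti numbers of such powers have the form `∑ c_k * k.choose i`, the face numbers of a complex with
`c_k` top vertices at level `k` over a chain. The shifted summand is realised by a cone over the
previous complex. For `m ≥ 1` the total coefficients are monotone and `c_0 = 2`, so the previous
complex embeds in the new one away from an isolated vertex, which serves as apex
(`map_shiftVertex_mem`, `apexComplex_down_closed`). -/

/-! ### Tor through a fixed resolution of the residue field. -/

section TensorHomology

open MonoidalCategory

variable {R : Type u} [CommRing R]

/-- The complex `M ⊗ P`, functorially in the module `M`. -/
noncomputable def tensorComplex (P : ChainComplex (ModuleCat.{u} R) ℕ) :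
    ModuleCat.{u} R ⥤ ChainComplex (ModuleCat.{u} R) ℕ where
  obj M := ((tensorLeft M).mapHomologicalComplex _).obj P
  map f := (NatTrans.mapHomologicalComplex ((tensoringLeft _).map f) _).app P

instance (P : ChainComplex (ModuleCat.{u} R) ℕ) : (tensorComplex P).Additive where
  map_add {X Y f g} := by
    ext n : 1
    change (f + g) ▷ P.X n = f ▷ P.X n + g ▷ P.X n
    simp

/-- The homology `H_i (M ⊗ P)`, functorially in `M`. -/
noncomputable def tensorHomology (P : ChainComplex (ModuleCat.{u} R) ℕ) (i : ℕ) :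
    ModuleCat.{u} R ⥤ ModuleCat.{u} R :=
  tensorComplex P ⋙ HomologicalComplex.homologyFunctor _ _ i

instance (P : ChainComplex (ModuleCat.{u} R) ℕ) (i : ℕ) : (tensorHomology P i).Additive := by
  unfold tensorHomology; infer_instance

/-- Projective modules are flat, so tensoring with each `P.X n` is exact. This gives long exact
sequences in the ideal while the resolution of the residue field stays fixed. -/
theorem tensorComplex_shortExact {P : ChainComplex (ModuleCat.{u} R) ℕ}
    (hP : ∀ n, Projective (P.X n)) {S : ShortComplex (ModuleCat.{u} R)} (hS : S.ShortExact) :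
    (S.map (tensorComplex P)).ShortExact := by
  apply HomologicalComplex.shortExact_of_degreewise_shortExact
  intro n
  have hp : Module.Projective R (P.X n) := (IsProjective.iff_projective (P.X n)).2 (hP n)
  have h : ((S.map (tensorRight (P.X n)))).ShortExact := by
    have := (Module.Flat.rTensor_shortComplex_exact (P.X n) S hS.exact)
    have hm : Mono ((S.map (tensorRight (P.X n))).f) := by
      have := hS.mono_f
      rw [ModuleCat.mono_iff_injective] at this ⊢
      exact Module.Flat.rTensor_preserves_injective_linearMap (M := P.X n) S.f.hom this
    have he : Epi ((S.map (tensorRight (P.X n))).g) := by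
      have := hS.epi_g
      rw [ModuleCat.epi_iff_surjective] at this ⊢
      exact LinearMap.rTensor_surjective (P.X n) this
    exact { exact := this }
  exact h

variable {P : ChainComplex (ModuleCat.{u} R) ℕ} {S : ShortComplex (ModuleCat.{u} R)}

/-- The connecting map of the long exact homology sequence. -/
noncomputable def tensorHomologyδ (hP : ∀ n, Projective (P.X n)) (hS : S.ShortExact)
    (i : ℕ) :
    (tensorHomology P (i + 1)).obj S.X₃ ⟶ (tensorHomology P i).obj S.X₁ :=
  (tensorComplex_shortExact hP hS).δ (i + 1) i (by simp)

theorem tensorHomology_exact₂ (hP : ∀ n, Projective (P.X n)) (hS : S.ShortExact)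
    (i : ℕ) :
    Function.Exact ((tensorHomology P i).map S.f).hom ((tensorHomology P i).map S.g).hom :=
  (ShortComplex.ShortExact.moduleCat_exact_iff_function_exact _).1
    ((tensorComplex_shortExact hP hS).homology_exact₂ i)

theorem tensorHomology_exact₃ (hP : ∀ n, Projective (P.X n)) (hS : S.ShortExact)
    (i : ℕ) :
    Function.Exact ((tensorHomology P (i + 1)).map S.g).hom (tensorHomologyδ hP hS i).hom :=
  (ShortComplex.ShortExact.moduleCat_exact_iff_function_exact _).1
    ((tensorComplex_shortExact hP hS).homology_exact₃ (i + 1) i (by simp))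

theorem tensorHomology_exact₁ (hP : ∀ n, Projective (P.X n)) (hS : S.ShortExact)
    (i : ℕ) :
    Function.Exact (tensorHomologyδ hP hS i).hom ((tensorHomology P i).map S.f).hom :=
  (ShortComplex.ShortExact.moduleCat_exact_iff_function_exact _).1
    ((tensorComplex_shortExact hP hS).homology_exact₁ (i + 1) i (by simp))

theorem tensorHomology_zero_surjective (hP : ∀ n, Projective (P.X n)) (hS : S.ShortExact)
    :
    Function.Surjective ((tensorHomology P 0).map S.g).hom := by
  have hg : Epi (S.map (tensorComplex P)).g := (tensorComplex_shortExact hP hS).epi_g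
  exact (ModuleCat.epi_iff_surjective _).1
    (HomologicalComplex.epi_homologyMap_of_epi_of_not_rel (S.map (tensorComplex P)).g 0 (by simp))

theorem tensorHomologyδ_naturality (hP : ∀ n, Projective (P.X n)) (hS : S.ShortExact)
    {S' : ShortComplex (ModuleCat.{u} R)} (hS' : S'.ShortExact)
    (φ : S ⟶ S') (i : ℕ) :
    tensorHomologyδ hP hS i ≫ (tensorHomology P i).map φ.τ₁ =
      (tensorHomology P (i + 1)).map φ.τ₃ ≫ tensorHomologyδ hP hS' i :=
  HomologicalComplex.HomologySequence.δ_naturality ((tensorComplex P).mapShortComplex.map φ)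
    (tensorComplex_shortExact hP hS) (tensorComplex_shortExact hP hS') (i + 1) i (by simp)

theorem tensorHomology_subsingleton_of_projective {k : ModuleCat.{u} R}
    (P : ProjectiveResolution k) (M : ModuleCat.{u} R) [Projective M] (i : ℕ) :
    Subsingleton ((tensorHomology P.complex (i + 1)).obj M) := by
  have hM : Module.Projective R M := (IsProjective.iff_projective M).2 ‹_›
  have : Limits.PreservesFiniteLimits (tensorLeft M) :=
    (Module.Flat.iff_preservesFiniteLimits_tensorLeft M).1 inferInstance
  rw [← ModuleCat.isZero_iff_subsingleton]
  exact (HomologicalComplex.exactAt_iff_isZero_homology _ _).1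
    ((P.complex_exactAt_succ i).map (tensorLeft M))

/-- Dimension shifting along the kernel of a projective presentation. Its contrapositive bounds the
projective dimension below by a nonzero Betti number. -/
theorem tensorHomology_subsingleton_of_hasProjectiveDimensionLT {k : ModuleCat.{u} R}
    (P : ProjectiveResolution k) (n : ℕ) (M : ModuleCat.{u} R) [HasProjectiveDimensionLT M n]
    (i : ℕ) (hi : n ≤ i) :
    Subsingleton ((tensorHomology P.complex i).obj M) := by
  induction n generalizing M i with
  | zero =>
    have hM : Limits.IsZero M := isZero_of_hasProjectiveDimensionLT_zero M
    exact ModuleCat.isZero_iff_subsingleton.1 ((tensorHomology P.complex i).map_isZero hM)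
  | succ n ih =>
    obtain ⟨i, rfl⟩ := Nat.exists_eq_succ_of_ne_zero (by omega : i ≠ 0)
    rcases n with _ | n
    · have : Projective M := projective_iff_hasProjectiveDimensionLT_one.2 ‹_›
      exact tensorHomology_subsingleton_of_projective P M i
    · let S := ShortComplex.mk (Limits.kernel.ι (Projective.π M)) (Projective.π M) (by simp)
      have hS : S.ShortExact := { exact := ShortComplex.exact_kernel _ }
      have hK : HasProjectiveDimensionLT S.X₁ (n + 1) :=
        (hS.hasProjectiveDimensionLT_X₃_iff n inferInstance).1 ‹_›
      have h1 := ih S.X₁ i (by omega)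
      have h2 := tensorHomology_subsingleton_of_projective P S.X₂ i
      refine ⟨fun x y => ?_⟩
      have hex := tensorHomology_exact₃ P.projective hS i
      have hz : ∀ z : (tensorHomology P.complex (i + 1)).obj S.X₃, z = 0 := fun z => by
        obtain ⟨w, rfl⟩ := (hex z).1 (Subsingleton.elim _ _)
        rw [Subsingleton.elim w 0, map_zero]
      exact (hz x).trans (hz y).symm

/-- `H_i (M ⊗ P)` computes `Tor` when `P` is a projective resolution. -/
noncomputable def torIsoTensorHomology {k : ModuleCat.{u} R} (P : ProjectiveResolution k)
    (M : ModuleCat.{u} R) (i : ℕ) :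
    ((Tor (ModuleCat.{u} R) i).obj M).obj k ≅ (tensorHomology P.complex i).obj M :=
  P.isoLeftDerivedObj ((tensoringLeft _).obj M) i

/-- `H_0 (M ⊗ P) = M ⊗ k`. -/
noncomputable def tensorHomologyZeroIso {k : ModuleCat.{u} R} (P : ProjectiveResolution k)
    (M : ModuleCat.{u} R) : (tensorHomology P.complex 0).obj M ≅ M ⊗ k := by
  have : Limits.PreservesFiniteColimits ((tensoringLeft (ModuleCat.{u} R)).obj M) :=
    inferInstanceAs (Limits.PreservesFiniteColimits (tensorLeft M))
  exact (P.isoLeftDerivedObj ((tensoringLeft _).obj M) 0).symm ≪≫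
    (((tensoringLeft (ModuleCat.{u} R)).obj M).leftDerivedZeroIsoSelf.app k)

/-- `H_0 (R ⊗ P) = k`. -/
noncomputable def tensorHomologyZeroUnit {k : ModuleCat.{u} R} (P : ProjectiveResolution k) :
    (tensorHomology P.complex 0).obj (ModuleCat.of R R) ≅ k :=
  tensorHomologyZeroIso P (𝟙_ _) ≪≫ λ_ k

end TensorHomology

/-! ### Linear resolutions without a grading. -/

section Detection

variable {R : Type u} [CommRing R]

/-- The module `V` is annihilated by the ideal `𝔪`. -/
def IsKilledBy (𝔪 : Ideal R) (V : ModuleCat.{u} R) : Prop :=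
  ∀ r ∈ 𝔪, ∀ x : V, r • x = 0

/-- Homology classes in `H_i (M ⊗ P)` are detected by the maps from `M` to modules killed by `𝔪`.
When `P` resolves the residue field of a graded ring, this says that `M` has a linear resolution,
up to the degrees of its generators. -/
def DetectedByHead (P : ChainComplex (ModuleCat.{u} R) ℕ) (𝔪 : Ideal R) (M : ModuleCat.{u} R) :
    Prop :=
  ∀ (i : ℕ) (z : (tensorHomology P i).obj M),
    (∀ V : ModuleCat.{u} R, IsKilledBy 𝔪 V → ∀ π : M ⟶ V, ((tensorHomology P i).map π).hom z = 0) →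
      z = 0

/-- Every map from the source of `f` to a module killed by `𝔪` extends along `f`. -/
def ExtendsToKilled (𝔪 : Ideal R) {M N : ModuleCat.{u} R} (f : M ⟶ N) : Prop :=
  ∀ V : ModuleCat.{u} R, IsKilledBy 𝔪 V → ∀ π : M ⟶ V, ∃ ρ : N ⟶ V, f ≫ ρ = π

variable {P : ChainComplex (ModuleCat.{u} R) ℕ} {𝔪 : Ideal R}

theorem tensorHomology_map_map (i : ℕ) {L M N : ModuleCat.{u} R} (f : L ⟶ M) (g : M ⟶ N)
    (z : (tensorHomology P i).obj L) :
    ((tensorHomology P i).map g).hom (((tensorHomology P i).map f).hom z) =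
      ((tensorHomology P i).map (f ≫ g)).hom z := by
  rw [Functor.map_comp]; rfl

theorem tensorHomology_map_zero (i : ℕ) {L M : ModuleCat.{u} R}
    (z : (tensorHomology P i).obj L) :
    ((tensorHomology P i).map (0 : L ⟶ M)).hom z = 0 := by
  rw [Functor.map_zero]; rfl

/-- A class that dies in `N` dies in every killed target of `M`, because the map to that target
passes through `N`. -/
theorem DetectedByHead.map_injective {M N : ModuleCat.{u} R} (hM : DetectedByHead P 𝔪 M)
    {f : M ⟶ N} (hf : ExtendsToKilled 𝔪 f) (i : ℕ) :
    Function.Injective ((tensorHomology P i).map f).hom := by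
  refine (injective_iff_map_eq_zero _).2 fun z hz => hM i z fun V hV π => ?_
  obtain ⟨ρ, rfl⟩ := hf V hV π
  rw [← tensorHomology_map_map, hz, map_zero]

/-- `f` induces zero maps to all modules killed by `𝔪`. -/
def IsZeroOnHeads (𝔪 : Ideal R) {M N : ModuleCat.{u} R} (f : M ⟶ N) : Prop :=
  ∀ V : ModuleCat.{u} R, IsKilledBy 𝔪 V → ∀ π : N ⟶ V, f ≫ π = 0

theorem DetectedByHead.map_eq_zero {M N : ModuleCat.{u} R} (hN : DetectedByHead P 𝔪 N)
    {f : M ⟶ N} (hf : IsZeroOnHeads 𝔪 f) (i : ℕ) (z : (tensorHomology P i).obj M) :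
    ((tensorHomology P i).map f).hom z = 0 := by
  refine hN i _ fun V hV π => ?_
  rw [tensorHomology_map_map, hf V hV π, tensorHomology_map_zero]

/-- Injectivity in every degree makes the connecting maps vanish. -/
theorem tensorHomology_map_surjective (hP : ∀ n, Projective (P.X n))
    {S : ShortComplex (ModuleCat.{u} R)} (hS : S.ShortExact)
    (h : ∀ i, Function.Injective ((tensorHomology P i).map S.f).hom) (i : ℕ) :
    Function.Surjective ((tensorHomology P i).map S.g).hom := by
  rcases i with _ | i
  · exact tensorHomology_zero_surjective hP hS
  · intro z
    refine (tensorHomology_exact₃ hP hS i z).1 (h i ?_)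
    rw [map_zero]
    exact (tensorHomology_exact₁ hP hS i _).2 ⟨z, rfl⟩

/-- An extension of detected modules is detected. -/
theorem DetectedByHead.of_extension (hP : ∀ n, Projective (P.X n))
    {S : ShortComplex (ModuleCat.{u} R)} (hS : S.ShortExact) (hf : ExtendsToKilled 𝔪 S.f)
    (h₁ : DetectedByHead P 𝔪 S.X₁) (h₃ : DetectedByHead P 𝔪 S.X₃) :
    DetectedByHead P 𝔪 S.X₂ := by
  intro i z hz
  have hgz : ((tensorHomology P i).map S.g).hom z = 0 := h₃ i _ fun V hV π => by
    rw [tensorHomology_map_map]; exact hz V hV _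
  obtain ⟨w, rfl⟩ := (tensorHomology_exact₂ hP hS i z).1 hgz
  have hw : w = 0 := h₁ i w fun V hV π => by
    obtain ⟨ρ, rfl⟩ := hf V hV π
    rw [← tensorHomology_map_map]; exact hz V hV ρ
  rw [hw, map_zero]

/-- The quotient of a detected module by a detected submodule lying in the radical part
`𝔪 • M` is detected, if maps to modules killed by `𝔪` extend from it to `𝔪 • M`. -/
theorem DetectedByHead.of_quotient (hP : ∀ n, Projective (P.X n))
    {S S' : ShortComplex (ModuleCat.{u} R)} (hS : S.ShortExact) (hS' : S'.ShortExact)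
    (φ : S ⟶ S') (hφ : ExtendsToKilled 𝔪 φ.τ₁) (hS₃ : IsKilledBy 𝔪 S'.X₃)
    (hf : IsZeroOnHeads 𝔪 S.f)
    (h₁ : DetectedByHead P 𝔪 S.X₁) (h₂ : DetectedByHead P 𝔪 S.X₂) :
    DetectedByHead P 𝔪 S.X₃ := by
  intro i z hz
  -- The connecting image of `z` is tested on a map to a killed module, extended to `S'.X₁`. By
  -- naturality the test factors through the image of `z` in the homology of the killed module
  -- `S'.X₃`, which is zero by hypothesis.
  have key : ∃ y, ((tensorHomology P i).map S.g).hom y = z := by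
    rcases i with _ | i
    · exact tensorHomology_zero_surjective hP hS z
    · refine (tensorHomology_exact₃ hP hS i z).1 (h₁ i _ fun V hV π => ?_)
      obtain ⟨ρ, rfl⟩ := hφ V hV π
      have hn := congrArg (fun f => f.hom z) (tensorHomologyδ_naturality hP hS hS' φ i)
      simp only [ModuleCat.hom_comp, LinearMap.comp_apply] at hn
      rw [← tensorHomology_map_map, hn, hz _ hS₃ φ.τ₃, map_zero, map_zero]
  obtain ⟨y, rfl⟩ := key
  have hy : y = 0 := h₂ i y fun V hV π => by
    have hg : Epi S.g := hS.epi_g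
    let ρ : S.X₃ ⟶ V := hS.exact.desc π (hf V hV π)
    have hρ : S.g ≫ ρ = π := hS.exact.g_desc _ _
    rw [← hρ, ← tensorHomology_map_map]
    exact hz V hV ρ
  rw [hy, map_zero]

end Detection

/-! ### Betti numbers in short exact sequences. -/

section Betti

variable {R : Type u} [CommRing R] (K : Type u) [Field K] [Algebra K R]

/-- The homology `H_i (M ⊗ P)` is finite-dimensional over `K`, of dimension `b i`. -/
def HasBetti (P : ChainComplex (ModuleCat.{u} R) ℕ) (M : ModuleCat.{u} R) (b : ℕ → ℕ) : Prop :=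
  ∀ i, Module.Finite K
      ((ModuleCat.restrictScalars (algebraMap K R)).obj ((tensorHomology P i).obj M)) ∧
    Module.finrank K
      ((ModuleCat.restrictScalars (algebraMap K R)).obj ((tensorHomology P i).obj M)) = b i

theorem finrank_of_shortExact {U V W : Type*} [AddCommGroup U] [AddCommGroup V] [AddCommGroup W]
    [Module K U] [Module K V] [Module K W] {f : U →ₗ[K] V} {g : V →ₗ[K] W}
    (hf : Function.Injective f) (hfg : Function.Exact f g) (hg : Function.Surjective g)
    [Module.Finite K U] [Module.Finite K W] :
    Module.Finite K V ∧ Module.finrank K V = Module.finrank K U + Module.finrank K W := by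
  have hker : LinearMap.ker g = LinearMap.range f := LinearMap.exact_iff.1 hfg
  have hV : Module.Finite K V := by
    have : Module.Finite K (V ⧸ LinearMap.range f) := by
      rw [← hker]
      exact Module.Finite.equiv (g.quotKerEquivOfSurjective hg).symm
    exact Module.Finite.of_submodule_quotient (LinearMap.range f)
  refine ⟨hV, ?_⟩
  rw [← LinearMap.finrank_range_add_finrank_ker g, hker, LinearMap.finrank_range_of_inj hf,
    LinearMap.range_eq_top.2 hg, finrank_top, add_comm]

variable {K} {P : ChainComplex (ModuleCat.{u} R) ℕ} {𝔪 : Ideal R}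

theorem HasBetti.of_extension (hP : ∀ n, Projective (P.X n))
    {S : ShortComplex (ModuleCat.{u} R)} (hS : S.ShortExact) (hf : ExtendsToKilled 𝔪 S.f)
    (h₁ : DetectedByHead P 𝔪 S.X₁) {b₁ b₃ : ℕ → ℕ} (hb₁ : HasBetti K P S.X₁ b₁)
    (hb₃ : HasBetti K P S.X₃ b₃) :
    HasBetti K P S.X₂ (b₁ + b₃) := by
  intro i
  have := (hb₁ i).1
  have := (hb₃ i).1
  have h := finrank_of_shortExact K
    (f := ((ModuleCat.restrictScalars (algebraMap K R)).map ((tensorHomology P i).map S.f)).hom)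
    (g := ((ModuleCat.restrictScalars (algebraMap K R)).map ((tensorHomology P i).map S.g)).hom)
    (h₁.map_injective hf i) (tensorHomology_exact₂ hP hS i)
    (tensorHomology_map_surjective hP hS (h₁.map_injective hf) i)
  rw [(hb₁ i).2, (hb₃ i).2] at h
  exact h

/-- The sequence `0, b 0, b 1, …`. -/
def shiftSeq (b : ℕ → ℕ) : ℕ → ℕ
  | 0 => 0
  | i + 1 => b i

theorem HasBetti.of_quotient (hP : ∀ n, Projective (P.X n))
    {S : ShortComplex (ModuleCat.{u} R)} (hS : S.ShortExact) (hf : IsZeroOnHeads 𝔪 S.f)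
    (h₂ : DetectedByHead P 𝔪 S.X₂) {b₁ b₂ : ℕ → ℕ} (hb₁ : HasBetti K P S.X₁ b₁)
    (hb₂ : HasBetti K P S.X₂ b₂) :
    HasBetti K P S.X₃ (b₂ + shiftSeq b₁) := by
  -- The maps `H(X₁) → H(X₂)` vanish, so the long sequence breaks into `0 → H_{i+1}(X₂) →
  -- H_{i+1}(X₃) → H_i(X₁) → 0`; this is the source of the shift.
  have hinj : ∀ i, Function.Injective ((tensorHomology P i).map S.g).hom := fun i =>
    (injective_iff_map_eq_zero _).2 fun z hz => by
      obtain ⟨w, rfl⟩ := (tensorHomology_exact₂ hP hS i z).1 hz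
      exact h₂.map_eq_zero hf i w
  intro i
  have := (hb₂ i).1
  rcases i with _ | i
  · let e := LinearEquiv.ofBijective
      ((ModuleCat.restrictScalars (algebraMap K R)).map ((tensorHomology P 0).map S.g)).hom
      ⟨hinj 0, tensorHomology_zero_surjective hP hS⟩
    exact ⟨Module.Finite.equiv e, by rw [← e.finrank_eq, (hb₂ 0).2]; rfl⟩
  · have := (hb₁ i).1
    have h := finrank_of_shortExact K
      (f := ((ModuleCat.restrictScalars (algebraMap K R)).map
        ((tensorHomology P (i + 1)).map S.g)).hom)
      (g := ((ModuleCat.restrictScalars (algebraMap K R)).map (tensorHomologyδ hP hS i)).hom)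
      (hinj (i + 1)) (tensorHomology_exact₃ hP hS i)
      (fun w => (tensorHomology_exact₁ hP hS i w).1 (h₂.map_eq_zero hf i w))
    rw [(hb₁ i).2, (hb₂ (i + 1)).2] at h
    exact h

theorem HasBetti.of_iso {M N : ModuleCat.{u} R} (e : M ≅ N) {b : ℕ → ℕ} (h : HasBetti K P M b) :
    HasBetti K P N b := by
  intro i
  have := (h i).1
  let e' := ((ModuleCat.restrictScalars (algebraMap K R)).mapIso
    ((tensorHomology P i).mapIso e)).toLinearEquiv
  exact ⟨Module.Finite.equiv e', by rw [← e'.finrank_eq, (h i).2]⟩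

theorem HasBetti.of_isZero {M : ModuleCat.{u} R} (hM : Limits.IsZero M) :
    HasBetti K P M 0 := by
  intro i
  have : Subsingleton ((ModuleCat.restrictScalars (algebraMap K R)).obj
      ((tensorHomology P i).obj M)) :=
    ModuleCat.isZero_iff_subsingleton.1 ((ModuleCat.restrictScalars _).map_isZero
      ((tensorHomology P i).map_isZero hM))
  exact ⟨inferInstance, Module.finrank_zero_of_subsingleton⟩

theorem DetectedByHead.of_isZero {M : ModuleCat.{u} R} (hM : Limits.IsZero M) :
    DetectedByHead P 𝔪 M := fun i _ _ =>
  (ModuleCat.isZero_iff_subsingleton.1 ((tensorHomology P i).map_isZero hM)).elim _ _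

theorem DetectedByHead.of_iso {M N : ModuleCat.{u} R} (e : M ≅ N) (h : DetectedByHead P 𝔪 M) :
    DetectedByHead P 𝔪 N := by
  intro i z hz
  have hi : ((tensorHomology P i).map e.inv).hom z = 0 := h i _ fun V hV π => by
    rw [tensorHomology_map_map]; exact hz V hV _
  have := congrArg ((tensorHomology P i).map e.hom).hom hi
  rw [tensorHomology_map_map, e.inv_hom_id, (tensorHomology P i).map_id, map_zero] at this
  exact this

end Betti

/-! ### The free module of rank one. -/

section Unit

open TensorProduct

variable {R : Type u} [CommRing R] {K : Type u} [Field K] [Algebra K R] {𝔪 : Ideal R}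
  (P : ProjectiveResolution (ModuleCat.of R (R ⧸ 𝔪)))

theorem hasBetti_unit (h : Module.finrank K (R ⧸ 𝔪) = 1) :
    HasBetti K P.complex (ModuleCat.of R R) (Pi.single 0 1) := by
  intro i
  rcases i with _ | i
  · let e := ((ModuleCat.restrictScalars (algebraMap K R)).mapIso
      (tensorHomologyZeroUnit P)).toLinearEquiv
    let e' : (ModuleCat.restrictScalars (algebraMap K R)).obj (ModuleCat.of R (R ⧸ 𝔪)) ≃ₗ[K]
        (R ⧸ 𝔪) :=
      { AddEquiv.refl (R ⧸ 𝔪) with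
        map_smul' := fun c x => by
          exact algebraMap_smul R c (show R ⧸ 𝔪 from x) }
    have hf : Module.Finite K (R ⧸ 𝔪) := Module.finite_of_finrank_eq_succ h
    refine ⟨Module.Finite.equiv (e.trans e').symm, ?_⟩
    rw [(e.trans e').finrank_eq, h]; rfl
  · have hs : Subsingleton ((ModuleCat.restrictScalars (algebraMap K R)).obj
        ((tensorHomology P.complex (i + 1)).obj (ModuleCat.of R R))) :=
      tensorHomology_subsingleton_of_projective P _ i
    exact ⟨inferInstance, by rw [Module.finrank_zero_of_subsingleton]; simp⟩

/-- Since `H_0 = R/𝔪` is simple, killing one nonzero class would make the map to `H_0` of `R/𝔪`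
zero. That map is onto, and `R/𝔪 ⊗ R/𝔪` is nonzero. -/
theorem detectedByHead_unit [h𝔪 : 𝔪.IsMaximal] :
    DetectedByHead P.complex 𝔪 (ModuleCat.of R R) := by
  intro i z hz
  rcases i with _ | i
  · let S := ShortComplex.mk (ModuleCat.ofHom 𝔪.subtype) (ModuleCat.ofHom 𝔪.mkQ)
      (by ext x; exact (Submodule.Quotient.mk_eq_zero 𝔪).2 x.2)
    have hS : S.ShortExact := ModuleCat.shortComplex_shortExact S
      (fun y => by
        change Submodule.Quotient.mk y = 0 ↔ _
        rw [Submodule.Quotient.mk_eq_zero]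
        exact ⟨fun h => ⟨⟨y, h⟩, rfl⟩, by rintro ⟨x, rfl⟩; exact x.2⟩)
      𝔪.injective_subtype 𝔪.mkQ_surjective
    have hk : IsKilledBy 𝔪 (ModuleCat.of R (R ⧸ 𝔪)) := fun r hr x => by
      obtain ⟨y, rfl⟩ := Submodule.Quotient.mk_surjective 𝔪 x
      exact (Submodule.Quotient.mk_eq_zero 𝔪).2 (𝔪.mul_mem_right y hr)
    by_contra hne
    have hsimple : IsSimpleModule R ((tensorHomology P.complex 0).obj (ModuleCat.of R R)) :=
      have : IsSimpleModule R (R ⧸ 𝔪) := isSimpleModule_iff_isCoatom.2 h𝔪.out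
      IsSimpleModule.congr (tensorHomologyZeroUnit P).toLinearEquiv
    have hker : LinearMap.ker ((tensorHomology P.complex 0).map S.g).hom = ⊤ :=
      (eq_bot_or_eq_top _).resolve_left fun h => hne ((Submodule.mem_bot R).1 (h ▸ hz _ hk S.g))
    have hT : ∀ w : (tensorHomology P.complex 0).obj S.X₃, w = 0 := fun w => by
      obtain ⟨y, rfl⟩ := tensorHomology_zero_surjective P.projective hS w
      exact LinearMap.mem_ker.1 (hker ▸ Submodule.mem_top)
    have e := (tensorHomologyZeroIso P S.X₃).toLinearEquiv
    have h0 : (1 : R ⧸ 𝔪) ⊗ₜ[R] (1 : R ⧸ 𝔪) = 0 := by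
      rw [← map_zero e, ← hT (e.symm ((1 : R ⧸ 𝔪) ⊗ₜ[R] (1 : R ⧸ 𝔪)))]
      exact (e.apply_symm_apply _).symm
    have h1 := congrArg (LinearMap.mul' R (R ⧸ 𝔪)) h0
    rw [LinearMap.mul'_apply, map_zero, mul_one] at h1
    exact one_ne_zero h1
  · exact (tensorHomology_subsingleton_of_projective P _ i).elim _ _

end Unit

/-! ### Ideals of the form `A + xB`. -/

section Ideals

variable {R : Type u} [CommRing R] {K : Type u} [Field K] [Algebra K R] {𝔪 : Ideal R}

/-- The inclusion of an ideal in a larger one, as a map of modules. -/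
def idealInclusion {A I : Ideal R} (h : A ≤ I) : ModuleCat.of R A ⟶ ModuleCat.of R I :=
  ModuleCat.ofHom (Submodule.inclusion h)

/-- The hypothesis `hAI` makes `A/𝔪A → I/𝔪I` injective. By `hK`, `R` acts on killed modules through
scalars of `K`, so it suffices to extend a linear map over a field. -/
theorem extendsToKilled_idealInclusion (hK : ∀ r : R, ∃ c : K, r - algebraMap K R c ∈ 𝔪)
    {A I : Ideal R} (h : A ≤ I) (hAI : A ⊓ 𝔪 * I ≤ 𝔪 * A) :
    ExtendsToKilled 𝔪 (idealInclusion h) := by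
  intro V hV π
  let _ : Module K V := Module.compHom V (algebraMap K R)
  have : IsScalarTower K R V := ⟨fun c r x => by
    rw [Algebra.smul_def, mul_smul]; rfl⟩
  have hkill : ∀ (M : Submodule R R) (σ : M →ₗ[R] V) (x : M), (x : R) ∈ 𝔪 • M → σ x = 0 := by
    intro M σ x hx
    rw [← Submodule.mem_smul_top_iff] at hx
    refine Submodule.smul_induction_on hx (fun r hr n _ => ?_) (fun x y hx hy => ?_)
    · rw [map_smul]; exact hV r hr _
    · rw [map_add, hx, hy, add_zero]
  let q : I →ₗ[K] (I ⧸ (𝔪 • ⊤ : Submodule R I)) := (Submodule.mkQ _).restrictScalars K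
  let α : A →ₗ[K] (I ⧸ (𝔪 • ⊤ : Submodule R I)) :=
    q.comp ((Submodule.inclusion h).restrictScalars K)
  let π' : A →ₗ[K] V := π.hom.restrictScalars K
  have hker : LinearMap.ker α ≤ LinearMap.ker π' := by
    intro a ha
    have ha' : Submodule.inclusion h a ∈ (𝔪 • ⊤ : Submodule R I) :=
      (Submodule.Quotient.mk_eq_zero _).1 ha
    rw [Submodule.mem_smul_top_iff] at ha'
    exact hkill A π.hom a (hAI ⟨a.2, ha'⟩)
  obtain ⟨g, hg⟩ := LinearMap.exists_extend
    (((LinearMap.ker α).liftQ π' hker).comp α.quotKerEquivRange.symm.toLinearMap)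
  have hgα : ∀ a, g (α a) = π' a := fun a => by
    have h1 := LinearMap.congr_fun hg ⟨α a, a, rfl⟩
    refine h1.trans ?_
    have h2 : α.quotKerEquivRange.symm ⟨α a, a, rfl⟩ = Submodule.Quotient.mk a := by
      rw [LinearEquiv.symm_apply_eq]; rfl
    rw [LinearMap.comp_apply, LinearEquiv.coe_coe, h2]; rfl
  let ρ : I →ₗ[R] V :=
    { toFun := fun x => g (q x)
      map_add' := fun x y => by rw [map_add, map_add]
      map_smul' := fun r x => by
        obtain ⟨c, hc⟩ := hK r
        have h1 : q (r • x) = c • q x := by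
          rw [← map_smul, ← sub_eq_zero, ← map_sub]
          refine (Submodule.Quotient.mk_eq_zero _).2 ?_
          rw [← algebraMap_smul R c x, ← sub_smul]
          exact Submodule.smul_mem_smul hc trivial
        rw [h1, map_smul, RingHom.id_apply, ← algebraMap_smul R c, ← sub_eq_zero, ← neg_sub,
          ← sub_smul, hV _ hc, neg_zero] }
  exact ⟨ModuleCat.ofHom ρ, by ext a; exact hgα a⟩

theorem isZeroOnHeads_idealInclusion {N B : Ideal R} (h : N ≤ B) (hNB : N ≤ 𝔪 * B) :
    IsZeroOnHeads 𝔪 (idealInclusion h) := by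
  intro V hV π
  ext n
  have hx : Submodule.inclusion h n ∈ (𝔪 • ⊤ : Submodule R B) := by
    rw [Submodule.mem_smul_top_iff]; exact hNB n.2
  change π.hom (Submodule.inclusion h n) = 0
  refine Submodule.smul_induction_on hx (fun r hr n _ => ?_) (fun x y hx hy => ?_)
  · rw [map_smul]; exact hV r hr _
  · rw [map_add, hx, hy, add_zero]

/-- The sequence `0 → N → B → B / N → 0`. -/
def idealSequence {N B : Ideal R} (h : N ≤ B) : ShortComplex (ModuleCat.{u} R) :=
  ShortComplex.mk (idealInclusion h) (ModuleCat.ofHom (N.submoduleOf B).mkQ)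
    (by ext x; exact (Submodule.Quotient.mk_eq_zero _).2 x.2)

theorem idealSequence_shortExact {N B : Ideal R} (h : N ≤ B) : (idealSequence h).ShortExact :=
  ModuleCat.shortComplex_shortExact _
    (fun y => (Submodule.Quotient.mk_eq_zero (N.submoduleOf B)).trans
      ⟨fun hy => ⟨⟨y.1, hy⟩, rfl⟩, by rintro ⟨x, rfl⟩; exact x.2⟩)
    (Submodule.inclusion_injective h) (Submodule.mkQ_surjective _)

section MulSequence

variable {A B : Ideal R} {x : R}

/-- Multiplication by `x` from `B` to `A + x B`. -/
def mulToSup (A B : Ideal R) (x : R) : B →ₗ[R] ↥(A ⊔ Ideal.span {x} * B) :=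
  LinearMap.codRestrict _ ((LinearMap.mulLeft R x).comp B.subtype) fun b =>
    Ideal.mem_sup_right (Ideal.mul_mem_mul (Ideal.mem_span_singleton_self x) b.2)

/-- Multiplication by `x` from `B` to the quotient of `A + x B` by `A`. -/
def mulToQuotient (A B : Ideal R) (x : R) :
    B →ₗ[R] (↥(A ⊔ Ideal.span {x} * B) ⧸ A.submoduleOf (A ⊔ Ideal.span {x} * B)) :=
  (Submodule.mkQ _).comp (mulToSup A B x)

theorem mulToQuotient_eq_zero_iff (b : B) : mulToQuotient A B x b = 0 ↔ x * b ∈ A :=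
  Submodule.Quotient.mk_eq_zero (A.submoduleOf (A ⊔ Ideal.span {x} * B)) (x := mulToSup A B x b)

theorem mulToQuotient_surjective : Function.Surjective (mulToQuotient A B x) := by
  intro y
  obtain ⟨⟨f, hf⟩, rfl⟩ := Submodule.mkQ_surjective _ y
  obtain ⟨a, ha, g, hg, rfl⟩ := Submodule.mem_sup.1 hf
  obtain ⟨b, hb, rfl⟩ := Ideal.mem_span_singleton_mul.1 hg
  refine ⟨⟨b, hb⟩, (Submodule.Quotient.eq _).2 ?_⟩
  change x * b - (a + x * b) ∈ A
  rw [sub_add_cancel_right]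
  exact A.neg_mem ha

/-- The sequence `0 → A ∩ B → B → (A + x B) / A → 0`, whose second map is multiplication
by `x`. -/
def mulSequence (hcol : ∀ b ∈ B, x * b ∈ A ↔ b ∈ A) : ShortComplex (ModuleCat.{u} R) :=
  ShortComplex.mk (idealInclusion (inf_le_right : A ⊓ B ≤ B))
    (ModuleCat.ofHom (mulToQuotient A B x))
    (ModuleCat.hom_ext (LinearMap.ext fun b : ↥(A ⊓ B) =>
      (mulToQuotient_eq_zero_iff (Submodule.inclusion inf_le_right b)).2
        ((hcol b.1 b.2.2).2 b.2.1)))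

theorem mulSequence_shortExact (hcol : ∀ b ∈ B, x * b ∈ A ↔ b ∈ A) :
    (mulSequence hcol).ShortExact :=
  ModuleCat.shortComplex_shortExact _
    (fun y => (mulToQuotient_eq_zero_iff y).trans
      ⟨fun hy => ⟨⟨y.1, (hcol y.1 y.2).1 hy, y.2⟩, rfl⟩, by
        rintro ⟨b, rfl⟩; exact (hcol b.1 b.2.2).2 b.2.1⟩)
    (Submodule.inclusion_injective inf_le_right) mulToQuotient_surjective

end MulSequence

/-- A property of ideals generated by forms of degree `s`, where `𝔪` is the ideal of the
variables. -/
structure IsGeneratedInDegree (𝔪 : Ideal R) (s : ℕ) (A : Ideal R) : Prop where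
  le_pow : A ≤ 𝔪 ^ s
  inf_pow_le : A ⊓ 𝔪 ^ (s + 1) ≤ 𝔪 * A

section Step

variable {P : ChainComplex (ModuleCat.{u} R) ℕ} {A B : Ideal R} {x : R} {s : ℕ}

theorem sup_span_mul_le_pow (hA : IsGeneratedInDegree 𝔪 (s + 1) A)
    (hB : IsGeneratedInDegree 𝔪 s B) (hx : x ∈ 𝔪) :
    A ⊔ Ideal.span {x} * B ≤ 𝔪 ^ (s + 1) := by
  refine sup_le hA.le_pow ?_
  rw [pow_succ']
  exact Ideal.mul_mono ((Ideal.span_singleton_le_iff_mem _).2 hx) hB.le_pow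

/-- Both summands lie in `𝔪 ^ (s + 1)`, so `𝔪(A + xB)` lies in `𝔪 ^ (s + 2)` and meets `A` inside
`𝔪A`: minimal generators of `A` stay minimal. -/
theorem extendsToKilled_sup (hK : ∀ r : R, ∃ c : K, r - algebraMap K R c ∈ 𝔪)
    (hA : IsGeneratedInDegree 𝔪 (s + 1) A) (hB : IsGeneratedInDegree 𝔪 s B) (hx : x ∈ 𝔪) :
    ExtendsToKilled 𝔪 (idealInclusion (le_sup_left : A ≤ A ⊔ Ideal.span {x} * B)) := by
  refine extendsToKilled_idealInclusion hK _ (le_trans (inf_le_inf_left A ?_) hA.inf_pow_le)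
  rw [pow_succ' 𝔪 (s + 1)]
  exact Ideal.mul_mono_right (sup_span_mul_le_pow hA hB hx)

/-- The generators of `B` have degree one less than those of `A`, which forces `A ∩ B` into `𝔪B`. -/
theorem isZeroOnHeads_inf (hA : IsGeneratedInDegree 𝔪 (s + 1) A)
    (hB : IsGeneratedInDegree 𝔪 s B) :
    IsZeroOnHeads 𝔪 (idealInclusion (inf_le_right : A ⊓ B ≤ B)) :=
  isZeroOnHeads_idealInclusion _
    (le_trans (le_inf inf_le_right (inf_le_left.trans hA.le_pow)) hB.inf_pow_le)

/-- Detection is required of `A` and `B` only. The intersection enters through its Betti numbers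
alone, so the recursion reaches cyclic ideals without any linearity for them. -/
theorem HasBetti.sup_span_mul (hP : ∀ n, Projective (P.X n))
    (hK : ∀ r : R, ∃ c : K, r - algebraMap K R c ∈ 𝔪)
    (hA : IsGeneratedInDegree 𝔪 (s + 1) A) (hB : IsGeneratedInDegree 𝔪 s B) (hx : x ∈ 𝔪)
    (hcol : ∀ b ∈ B, x * b ∈ A ↔ b ∈ A)
    (hdA : DetectedByHead P 𝔪 (ModuleCat.of R A)) (hdB : DetectedByHead P 𝔪 (ModuleCat.of R B))
    {a b c : ℕ → ℕ} (ha : HasBetti K P (ModuleCat.of R A) a)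
    (hb : HasBetti K P (ModuleCat.of R B) b)
    (hc : HasBetti K P (ModuleCat.of R ↥(A ⊓ B)) c) :
    HasBetti K P (ModuleCat.of R ↥(A ⊔ Ideal.span {x} * B)) (a + (b + shiftSeq c)) :=
  HasBetti.of_extension hP (idealSequence_shortExact (le_sup_left : A ≤ A ⊔ Ideal.span {x} * B))
    (extendsToKilled_sup hK hA hB hx) hdA ha
    (HasBetti.of_quotient (S := mulSequence hcol) hP (mulSequence_shortExact hcol)
      (isZeroOnHeads_inf hA hB) hdB hc hb : HasBetti K P
        (ModuleCat.of R (↥(A ⊔ Ideal.span {x} * B) ⧸ A.submoduleOf (A ⊔ Ideal.span {x} * B))) _)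

/-- When `A ≤ B` the kernel `A ∩ B` is `A`, hence detected. The quotient criterion then applies by
comparison with `0 → 𝔪B → B → B/𝔪B → 0`. -/
theorem DetectedByHead.sup_span_mul (hP : ∀ n, Projective (P.X n))
    (hK : ∀ r : R, ∃ c : K, r - algebraMap K R c ∈ 𝔪)
    (hA : IsGeneratedInDegree 𝔪 (s + 1) A) (hB : IsGeneratedInDegree 𝔪 s B) (hx : x ∈ 𝔪)
    (hcol : ∀ b ∈ B, x * b ∈ A ↔ b ∈ A) (hAB : A ≤ B)
    (hdA : DetectedByHead P 𝔪 (ModuleCat.of R A)) (hdB : DetectedByHead P 𝔪 (ModuleCat.of R B)) :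
    DetectedByHead P 𝔪 (ModuleCat.of R ↥(A ⊔ Ideal.span {x} * B)) := by
  have hinf : A ⊓ B = A := inf_eq_left.2 hAB
  have hle : A ⊓ B ≤ 𝔪 * B :=
    le_trans (le_inf inf_le_right (inf_le_left.trans hA.le_pow)) hB.inf_pow_le
  have hmB : 𝔪 * B ≤ B := Ideal.mul_le_right
  have hS := mulSequence_shortExact hcol
  have hS' := idealSequence_shortExact hmB
  have hg : Epi (mulSequence hcol).g := hS.epi_g
  let τ : (mulSequence hcol).X₃ ⟶ (idealSequence hmB).X₃ :=
    hS.exact.desc (idealSequence hmB).g (by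
      ext b; exact (Submodule.Quotient.mk_eq_zero _).2 (hle b.2))
  have hτ : (mulSequence hcol).g ≫ τ = (idealSequence hmB).g := hS.exact.g_desc _ _
  let φ : mulSequence hcol ⟶ idealSequence hmB :=
    { τ₁ := idealInclusion hle
      τ₂ := 𝟙 (ModuleCat.of R B)
      τ₃ := τ
      comm₁₂ := rfl
      comm₂₃ := (Category.id_comp _).trans hτ.symm }
  refine DetectedByHead.of_extension hP (idealSequence_shortExact (le_sup_left : A ≤ A ⊔ Ideal.span {x} * B))
    (extendsToKilled_sup hK hA hB hx) hdA
    (DetectedByHead.of_quotient (S := mulSequence hcol) hP hS hS' φ ?_ ?_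
      (isZeroOnHeads_inf hA hB) ?_ hdB)
  · refine extendsToKilled_idealInclusion hK hle ?_
    rw [hinf]
    refine le_trans (inf_le_inf_left A ?_) hA.inf_pow_le
    rw [pow_succ', pow_succ']
    exact Ideal.mul_mono_right (Ideal.mul_mono_right hB.le_pow)
  · intro r hr y
    obtain ⟨b, rfl⟩ := Submodule.mkQ_surjective _ y
    exact (Submodule.Quotient.mk_eq_zero _).2 (Ideal.mul_mem_mul hr b.2)
  · change DetectedByHead P 𝔪 (ModuleCat.of R ↥(A ⊓ B))
    rw [hinf]; exact hdA

theorem hasProjectiveDimensionLT_sup_span_mul (hcol : ∀ b ∈ B, x * b ∈ A ↔ b ∈ A) (n : ℕ)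
    (hA : HasProjectiveDimensionLT (ModuleCat.of R A) (n + 1))
    (hB : HasProjectiveDimensionLT (ModuleCat.of R B) (n + 1))
    (hN : HasProjectiveDimensionLT (ModuleCat.of R ↥(A ⊓ B)) n) :
    HasProjectiveDimensionLT (ModuleCat.of R ↥(A ⊔ Ideal.span {x} * B)) (n + 1) :=
  (idealSequence_shortExact (le_sup_left : A ≤ A ⊔ Ideal.span {x} * B)).hasProjectiveDimensionLT_X₂
    (n + 1) hA ((mulSequence_shortExact hcol).hasProjectiveDimensionLT_X₃ n hN hB)

end Step

end Ideals

/-! ### Squarefree monomial ideals described by supports. -/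

section SupportIdeal

open MvPolynomial

variable {K : Type u} [Field K] {ι : Type}

/-- The squarefree monomial ideal spanned by the monomials whose support satisfies `U`. -/
noncomputable def supportIdeal (K : Type u) [Field K] {ι : Type} {U : Set ι → Prop}
    (hU : Monotone U) : Ideal (MvPolynomial ι K) :=
  restrictSupportIdeal K {m : ι →₀ ℕ | U (m.support : Set ι)}
    fun _ _ hab => hU (Finset.coe_subset.2 (Finsupp.support_mono hab))

variable {U V : Set ι → Prop} {hU : Monotone U} {hV : Monotone V}

theorem mem_supportIdeal {f : MvPolynomial ι K} :
    f ∈ supportIdeal K hU ↔ ∀ m ∈ f.support, U (m.support : Set ι) := by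
  change f ∈ (supportIdeal K hU).restrictScalars K ↔ _
  exact (mem_restrictSupport_iff (s := {m : ι →₀ ℕ | U (m.support : Set ι)}) (r := f))

theorem monomial_mem_supportIdeal {m : ι →₀ ℕ} (hm : U (m.support : Set ι)) (c : K) :
    monomial m c ∈ supportIdeal K hU := by
  classical
  rw [mem_supportIdeal]
  intro m' hm'
  rwa [Finset.mem_singleton.1 (support_monomial_subset hm')]

theorem supportIdeal_inf (h : Monotone fun W => U W ∧ V W) :
    supportIdeal K hU ⊓ supportIdeal K hV = supportIdeal K h := by
  ext f
  simp only [Submodule.mem_inf, mem_supportIdeal]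
  exact ⟨fun h m hm => ⟨h.1 m hm, h.2 m hm⟩,
    fun h => ⟨fun m hm => (h m hm).1, fun m hm => (h m hm).2⟩⟩

theorem supportIdeal_mono (h : ∀ W, U W → V W) : supportIdeal K hU ≤ supportIdeal K hV :=
  fun _ hf => mem_supportIdeal.2 fun m hm => h _ (mem_supportIdeal.1 hf m hm)

theorem supportIdeal_eq_bot (h : ∀ W, ¬ U W) : supportIdeal K hU = ⊥ := by
  rw [eq_bot_iff]
  intro f hf
  rw [Submodule.mem_bot, ← support_eq_empty]
  exact Finset.eq_empty_of_forall_notMem fun m hm => h _ (mem_supportIdeal.1 hf m hm)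

theorem supportIdeal_eq_top (h : ∀ W, U W) : supportIdeal K hU = ⊤ :=
  eq_top_iff.2 fun _ _ => mem_supportIdeal.2 fun _ _ => h _

theorem mem_of_monomials_mem {I : Ideal (MvPolynomial ι K)} {f : MvPolynomial ι K}
    (h : ∀ m ∈ f.support, monomial m (coeff m f) ∈ I) : f ∈ I := by
  rw [f.as_sum]; exact I.sum_mem h

theorem X_mul_mem_supportIdeal_iff {j : ι} (h : ∀ W, U (insert j W) → U W)
    {f : MvPolynomial ι K} : X j * f ∈ supportIdeal K hU ↔ f ∈ supportIdeal K hU := by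
  classical
  refine ⟨fun hf => mem_supportIdeal.2 fun m hm => h _ ?_, Ideal.mul_mem_left _ _⟩
  refine hU ?_ (mem_supportIdeal.1 hf (Finsupp.single j 1 + m) ?_)
  · intro i hi
    have hi' := Finsupp.support_add (Finset.mem_coe.1 hi)
    rcases Finset.mem_union.1 hi' with hi' | hi'
    · exact Or.inl (Finset.mem_singleton.1 (Finsupp.support_single_subset hi'))
    · exact Or.inr hi'
  · rw [mem_support_iff, coeff_X_mul]; exact mem_support_iff.1 hm

theorem monomial_eq_X_mul {m : ι →₀ ℕ} {j : ι} (hj : m j ≠ 0) (c : K) :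
    monomial m c = X j * monomial (m - Finsupp.single j 1) c := by
  rw [X, monomial_mul, one_mul, add_tsub_cancel_of_le]
  exact Finsupp.single_le_iff.2 (Nat.one_le_iff_ne_zero.2 hj)

theorem supportIdeal_eq_sup {UI : Set ι → Prop} {hUI : Monotone UI} {j : ι}
    (h : ∀ W, UI W ↔ U W ∨ (j ∈ W ∧ V W)) (hj : ∀ W, V (insert j W) → V W) :
    supportIdeal K hUI = supportIdeal K hU ⊔ Ideal.span {X j} * supportIdeal K hV := by
  classical
  apply le_antisymm
  · intro f hf
    refine mem_of_monomials_mem fun m hm => ?_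
    rcases (h _).1 (mem_supportIdeal.1 hf m hm) with hm' | ⟨hjm, hm'⟩
    · exact Ideal.mem_sup_left (monomial_mem_supportIdeal hm' _)
    · refine Ideal.mem_sup_right ?_
      rw [monomial_eq_X_mul (Finsupp.mem_support_iff.1 hjm)]
      refine Ideal.mul_mem_mul (Ideal.mem_span_singleton_self _) (monomial_mem_supportIdeal ?_ _)
      -- Dividing by `X j` may remove `j` from the support, which `V` does not notice.
      refine hj _ (hV ?_ hm')
      intro i hi
      by_cases hij : i = j
      · exact Or.inl hij
      · refine Or.inr ?_
        rw [Finset.mem_coe, Finsupp.mem_support_iff, Finsupp.tsub_apply,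
          Finsupp.single_eq_of_ne hij]
        exact Finsupp.mem_support_iff.1 hi
  · refine sup_le (supportIdeal_mono fun W hW => (h W).2 (Or.inl hW)) ?_
    rw [Ideal.mul_le]
    intro r hr b hb
    obtain ⟨c, rfl⟩ := Ideal.mem_span_singleton'.1 hr
    rw [mul_assoc]
    refine Ideal.mul_mem_left _ _ (mem_supportIdeal.2 fun m hm => (h _).2 (Or.inr ?_))
    rw [support_X_mul, Finset.mem_map] at hm
    obtain ⟨m', hm', rfl⟩ := hm
    refine ⟨by simp, hV ?_ (mem_supportIdeal.1 hb m' hm')⟩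
    intro i hi
    rw [Finset.mem_coe, Finsupp.mem_support_iff] at hi ⊢
    simp only [addLeftEmbedding_apply, Finsupp.add_apply]
    omega

theorem card_support_le_degree (m : ι →₀ ℕ) : m.support.card ≤ m.degree := by
  rw [Finset.card_eq_sum_ones, Finsupp.degree]
  exact Finset.sum_le_sum fun i hi => Nat.one_le_iff_ne_zero.2 (Finsupp.mem_support_iff.1 hi)

theorem isGeneratedInDegree_supportIdeal {s : ℕ} (hcard : ∀ W : Finset ι, U W → s ≤ W.card)
    (hgen : ∀ W : Finset ι, U W → ∃ F ⊆ W, F.card = s ∧ U F) :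
    IsGeneratedInDegree (variablesIdeal K ι) s (supportIdeal K hU) where
  le_pow f hf := (mem_pow_idealOfVars_iff s f).2 fun m hm =>
    (hcard _ (mem_supportIdeal.1 hf m hm)).trans (card_support_le_degree m)
  inf_pow_le := by
    classical
    rintro f ⟨hf, hf'⟩
    refine mem_of_monomials_mem fun m hm => ?_
    have hdeg := (mem_pow_idealOfVars_iff (s + 1) f).1 hf' m hm
    obtain ⟨F, hFm, hFs, hF⟩ := hgen _ (mem_supportIdeal.1 hf m hm)
    -- The degree of `m` exceeds `s = |F|`, so some variable divides out with `F` still in the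
    -- support: it lies outside `F` or has exponent at least two.
    obtain ⟨j, hj, hjF⟩ : ∃ j, m j ≠ 0 ∧ (j ∈ F → 2 ≤ m j) := by
      by_contra! hcon
      have hsub : m.support ⊆ F := fun j hj => (hcon j (Finsupp.mem_support_iff.1 hj)).1
      have : m.degree ≤ F.card := by
        rw [Finsupp.degree, Finset.card_eq_sum_ones]
        refine (Finset.sum_le_sum fun i hi => ?_).trans (Finset.sum_le_sum_of_subset hsub)
        have := (hcon i (Finsupp.mem_support_iff.1 hi)).2
        omega
      omega
    rw [monomial_eq_X_mul hj]
    refine Ideal.mul_mem_mul (Ideal.subset_span ⟨j, rfl⟩) (monomial_mem_supportIdeal (hU ?_ hF) _)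
    intro i hi
    have him := Finsupp.mem_support_iff.1 (hFm hi)
    rw [Finset.mem_coe, Finsupp.mem_support_iff, Finsupp.tsub_apply]
    by_cases hij : i = j
    · subst hij
      have := hjF hi
      rw [Finsupp.single_eq_same]
      omega
    · rw [Finsupp.single_eq_of_ne hij]; exact him

theorem supportIdeal_eq_span_prod (F : Finset ι) (h : ∀ W, U W ↔ (F : Set ι) ⊆ W) :
    supportIdeal K hU = Ideal.span {∏ i ∈ F, X i} := by
  classical
  have hprod : (∏ i ∈ F, X i : MvPolynomial ι K) = monomial (∑ i ∈ F, Finsupp.single i 1) 1 := by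
    rw [monomial_sum_one]; rfl
  have happ : ∀ i, (∑ j ∈ F, Finsupp.single j 1 : ι →₀ ℕ) i = if i ∈ F then 1 else 0 := fun i => by
    simp [Finsupp.finsetSum_apply, Finsupp.single_apply]
  apply le_antisymm
  · intro f hf
    refine mem_of_monomials_mem fun m hm => ?_
    have hm' := (h _).1 (mem_supportIdeal.1 hf m hm)
    rw [hprod, Ideal.mem_span_singleton, monomial_dvd_monomial]
    refine ⟨Or.inr fun i => ?_, one_dvd _⟩
    rw [happ]
    split_ifs with hi
    · exact Nat.one_le_iff_ne_zero.2 (Finsupp.mem_support_iff.1 (hm' hi))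
    · exact Nat.zero_le _
  · rw [Ideal.span_singleton_le_iff_mem, hprod]
    refine monomial_mem_supportIdeal ((h _).2 fun i hi => ?_) _
    rw [Finset.mem_coe, Finsupp.mem_support_iff, happ, if_pos (Finset.mem_coe.1 hi)]
    exact one_ne_zero

theorem exists_sub_C_mem_variablesIdeal (r : MvPolynomial ι K) :
    ∃ c : K, r - algebraMap K (MvPolynomial ι K) c ∈ variablesIdeal K ι := by
  classical
  refine ⟨coeff 0 r, ?_⟩
  change _ ∈ idealOfVars ι K
  rw [← pow_one (idealOfVars ι K), mem_pow_idealOfVars_iff']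
  intro m hm
  have hm0 : m = 0 := by
    rw [Nat.lt_one_iff] at hm
    exact (Finsupp.degree_eq_zero_iff m).1 hm
  subst hm0
  rw [coeff_sub, algebraMap_eq, coeff_zero_C, sub_self]

theorem variablesIdeal_ne_top : variablesIdeal K ι ≠ ⊤ := by
  rw [Ne, Ideal.eq_top_iff_one]
  change 1 ∉ idealOfVars ι K
  rw [← C_1, ← pow_one (idealOfVars ι K), C_mem_pow_idealOfVars_iff]
  simp

theorem bijective_algebraMap_quotient_variablesIdeal :
    Function.Bijective (Algebra.linearMap K (MvPolynomial ι K ⧸ variablesIdeal K ι)) := by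
  have : Nontrivial (MvPolynomial ι K ⧸ variablesIdeal K ι) :=
    Ideal.Quotient.nontrivial_iff.2 variablesIdeal_ne_top
  refine ⟨(algebraMap K (MvPolynomial ι K ⧸ variablesIdeal K ι)).injective, fun y => ?_⟩
  obtain ⟨r, rfl⟩ := Ideal.Quotient.mk_surjective y
  obtain ⟨c, hc⟩ := exists_sub_C_mem_variablesIdeal r
  exact ⟨c, (Ideal.Quotient.eq.2 hc).symm⟩

theorem finrank_quotient_variablesIdeal :
    Module.finrank K (MvPolynomial ι K ⧸ variablesIdeal K ι) = 1 := by
  rw [← (LinearEquiv.ofBijective _ bijective_algebraMap_quotient_variablesIdeal).finrank_eq,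
    Module.finrank_self]

instance variablesIdeal_isMaximal : (variablesIdeal K ι).IsMaximal :=
  Ideal.Quotient.maximal_of_isField _
    (MulEquiv.isField (Field.toIsField K)
      (RingEquiv.ofBijective (algebraMap K (MvPolynomial ι K ⧸ variablesIdeal K ι))
        bijective_algebraMap_quotient_variablesIdeal).symm.toMulEquiv)

end SupportIdeal

/-! ### Combinatorics of pairwise nonconsecutive positions. -/

section Separated

/-- The set `W` contains `s` elements of the interval `[lo, hi)`, no two of them consecutive. -/
def HasSeparated (lo hi s : ℕ) (W : Set ℕ) : Prop :=
  ∃ f : ℕ → ℕ, (∀ k < s, lo ≤ f k ∧ f k < hi ∧ f k ∈ W) ∧ ∀ k, k + 1 < s → f k + 2 ≤ f (k + 1)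

variable {lo hi s : ℕ} {W : Set ℕ}

theorem HasSeparated.mono {lo' hi' : ℕ} {W' : Set ℕ} (h : HasSeparated lo hi s W)
    (hlo : lo' ≤ lo) (hhi : hi ≤ hi') (hW : W ⊆ W') : HasSeparated lo' hi' s W' := by
  obtain ⟨f, hf, hf'⟩ := h
  exact ⟨f, fun k hk => ⟨hlo.trans (hf k hk).1, (hf k hk).2.1.trans_le hhi, hW (hf k hk).2.2⟩, hf'⟩

theorem hasSeparated_zero : HasSeparated lo hi 0 W :=
  ⟨id, fun _ hk => absurd hk (Nat.not_lt_zero _), fun _ hk => absurd hk (Nat.not_lt_zero _)⟩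

/-- Either the largest chosen element is below `hi`, or it equals `hi` and separation pushes the
others below `hi - 1`. -/
theorem hasSeparated_succ_iff (hlo : lo ≤ hi) :
    HasSeparated lo (hi + 1) (s + 1) W ↔
      HasSeparated lo hi (s + 1) W ∨ (hi ∈ W ∧ HasSeparated lo (hi - 1) s W) := by
  constructor
  · rintro ⟨f, hf, hf'⟩
    have hstep : ∀ k < s, f k + 2 ≤ hi := fun k hk => by
      have := hf' k (by omega); have := (hf (k + 1) (by omega)).2.1; omega
    rcases (Nat.lt_succ_iff.1 (hf s (by omega)).2.1).lt_or_eq with h | h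
    · refine Or.inl ⟨f, fun k hk => ⟨(hf k hk).1, ?_, (hf k hk).2.2⟩, hf'⟩
      rcases (Nat.lt_succ_iff.1 hk).lt_or_eq with hk' | rfl
      · have := hstep k hk'; omega
      · exact h
    · refine Or.inr ⟨h ▸ (hf s (by omega)).2.2, f, fun k hk => ⟨(hf k (by omega)).1, ?_,
        (hf k (by omega)).2.2⟩, fun k hk => hf' k (by omega)⟩
      have := hstep k hk; omega
  · rintro (h | ⟨hW, f, hf, hf'⟩)
    · exact h.mono le_rfl (Nat.le_succ _) subset_rfl
    · refine ⟨fun k => if k < s then f k else hi, fun k hk => ?_, fun k hk => ?_⟩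
      · dsimp only
        split_ifs with h
        · have := hf k h; exact ⟨this.1, by omega, this.2.2⟩
        · exact ⟨hlo, Nat.lt_succ_self _, hW⟩
      · dsimp only
        have h1 := hf k (by omega)
        rw [if_pos (by omega : k < s)]
        split_ifs with h
        · exact hf' k h
        · omega

theorem HasSeparated.pred (h : HasSeparated lo hi (s + 1) W) : HasSeparated lo (hi - 1) s W := by
  obtain ⟨f, hf, hf'⟩ := h
  refine ⟨f, fun k hk => ⟨(hf k (by omega)).1, ?_, (hf k (by omega)).2.2⟩,
    fun k hk => hf' k (by omega)⟩
  have := hf' k (by omega); have := (hf (k + 1) (by omega)).2.1; omega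

theorem HasSeparated.of_insert {j : ℕ} (hj : hi ≤ j) (h : HasSeparated lo hi s (insert j W)) :
    HasSeparated lo hi s W := by
  obtain ⟨f, hf, hf'⟩ := h
  refine ⟨f, fun k hk => ⟨(hf k hk).1, (hf k hk).2.1, (hf k hk).2.2.resolve_left ?_⟩, hf'⟩
  have := (hf k hk).2.1; omega

theorem separated_lower {f : ℕ → ℕ} (hf : ∀ k < s, lo ≤ f k)
    (hf' : ∀ k, k + 1 < s → f k + 2 ≤ f (k + 1)) (k : ℕ) (hk : k < s) : lo + 2 * k ≤ f k := by
  induction k with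
  | zero => exact hf 0 hk
  | succ k ih => have := ih (by omega); have := hf' k hk; omega

theorem separated_upper {f : ℕ → ℕ} (hf : ∀ k < s, f k < hi)
    (hf' : ∀ k, k + 1 < s → f k + 2 ≤ f (k + 1)) (j k : ℕ) (hk : k + j + 1 = s) :
    f k + 2 * j < hi := by
  induction j generalizing k with
  | zero => exact hf k (by omega)
  | succ j ih => have := ih (k + 1) (by omega); have := hf' k (by omega); omega

theorem not_hasSeparated (h : hi ≤ lo + 2 * s) : ¬ HasSeparated lo hi (s + 1) W := by
  rintro ⟨f, hf, hf'⟩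
  have := separated_lower (fun k hk => (hf k hk).1) hf' s (by omega)
  have := (hf s (by omega)).2.1
  omega

/-- The combinatorial description of the nonfaces of the cyclic polytope `C(n, 2 m)`. -/
def IsCyclicNonface (n m : ℕ) (W : Set ℕ) : Prop :=
  HasSeparated 0 n (m + 1) W ∧ HasSeparated 1 (n - 1) m W

/-- An exchange argument between `f`, with `m + 1` elements, and `g`, with `m` interior elements. If
`f` ends at `n`, one tries to follow one family up to an index and the other afterwards. When no
switch is possible, the two interleave so tightly that `hn` keeps `f` away from `0`. -/
theorem isCyclicNonface_succ_iff {n m : ℕ} (hn : 2 * m + 1 ≤ n) :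
    IsCyclicNonface (n + 1) m W ↔
      HasSeparated 0 n (m + 1) W ∨ (n ∈ W ∧ HasSeparated 1 (n - 1) m W) := by
  constructor
  · rintro ⟨⟨f, hf, hf'⟩, ⟨g, hg, hg'⟩⟩
    simp only [Nat.add_sub_cancel] at hg
    have hstep : ∀ k < m, f k + 2 ≤ n := fun k hk => by
      have := hf' k (by omega); have := (hf (k + 1) (by omega)).2.1; omega
    rcases (Nat.lt_succ_iff.1 (hf m (by omega)).2.1).lt_or_eq with h | h
    · refine Or.inl ⟨f, fun k hk => ⟨(hf k hk).1, ?_, (hf k hk).2.2⟩, hf'⟩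
      rcases (Nat.lt_succ_iff.1 hk).lt_or_eq with hk' | rfl
      · have := hstep k hk'; omega
      · exact h
    have hnW : n ∈ W := h ▸ (hf m (by omega)).2.2
    -- Switching from `g` to `f` after index `k` and omitting the last element `n` of `f` leaves `m`
    -- separated interior positions.
    by_cases h1 : ∃ k < m, g k + 2 ≤ f (k + 1)
    · obtain ⟨k, hk, hgf⟩ := h1
      refine Or.inr ⟨hnW, fun i => if i ≤ k then g i else f i, fun i hi => ?_, fun i hi => ?_⟩
      · dsimp only
        split_ifs with hik
        · refine ⟨(hg i hi).1, ?_, (hg i hi).2.2⟩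
          rcases hik.lt_or_eq with hik | rfl
          · have := hg' i (by omega); have := (hg (i + 1) (by omega)).2.1; omega
          · have := (hf (i + 1) (by omega)).2.1; omega
        · refine ⟨?_, ?_, (hf i (by omega)).2.2⟩
          · have := hf' (i - 1) (by omega); rw [Nat.sub_add_cancel (by omega)] at this; omega
          · have := hstep i hi; omega
      · dsimp only
        split_ifs with h2 h3
        · exact hg' i hi
        · obtain rfl : i = k := by omega
          exact hgf
        · omega
        · exact hf' i (by omega)
    -- Switching from `f` to `g` gains one index, giving `m + 1` positions below `n`.
    by_cases h2 : ∃ k < m, f k + 2 ≤ g k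
    · obtain ⟨k, hk, hfg⟩ := h2
      refine Or.inl ⟨fun i => if i ≤ k then f i else g (i - 1), fun i hi => ?_, fun i hi => ?_⟩
      · dsimp only
        split_ifs with hik
        · refine ⟨Nat.zero_le _, ?_, (hf i (by omega)).2.2⟩
          have := hstep i (by omega); omega
        · exact ⟨Nat.zero_le _, (hg (i - 1) (by omega)).2.1, (hg (i - 1) (by omega)).2.2⟩
      · dsimp only
        split_ifs with h2 h3
        · exact hf' i (by omega)
        · obtain rfl : i = k := by omega
          exact hfg
        · omega
        · have := hg' (i - 1) (by omega)
          rw [Nat.sub_add_cancel (by omega)] at this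
          exact this
    by_cases h3 : m = 0
    · subst h3; exact Or.inr ⟨hnW, hasSeparated_zero⟩
    by_cases h4 : f 0 = 0
    -- Now `f (k + 1) ≤ g k + 1 ≤ f k + 2`, so `f 0 = 0` would give `n = f m ≤ 2 * m`.
    · push Not at h1 h2
      have hle : ∀ k ≤ m, f k ≤ 2 * k := by
        intro k
        induction k with
        | zero => intro _; omega
        | succ k ih =>
          intro hk
          have := ih (by omega); have := h1 k (by omega); have := h2 k (by omega); omega
      have := hle m le_rfl; omega
    · refine Or.inr ⟨hnW, f, fun k hk => ⟨?_, ?_, (hf k (by omega)).2.2⟩,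
        fun k hk => hf' k (by omega)⟩
      · have := separated_lower (lo := 0) (fun k _ => Nat.zero_le (f k)) hf' k (by omega)
        rcases Nat.eq_zero_or_pos k with rfl | hk0 <;> omega
      · have := hstep k hk; omega
  · rintro (h | ⟨hnW, h⟩)
    · refine ⟨h.mono le_rfl (Nat.le_succ n) subset_rfl, ?_⟩
      obtain ⟨f, hf, hf'⟩ := h
      refine ⟨fun k => f (k + 1), fun k hk => ⟨?_, (hf (k + 1) (by omega)).2.1,
        (hf (k + 1) (by omega)).2.2⟩, fun k hk => hf' (k + 1) (by omega)⟩
      have := hf' k (by omega)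
      dsimp only
      omega
    · exact ⟨(hasSeparated_succ_iff (Nat.zero_le n)).2
        (Or.inr ⟨hnW, h.mono (Nat.zero_le 1) le_rfl subset_rfl⟩),
        h.mono le_rfl (by omega) subset_rfl⟩

/-- There is no slack: the `m + 1` separated positions must be all the even ones and the `m`
interior ones all the odd ones. -/
theorem isCyclicNonface_base_iff {m : ℕ} :
    IsCyclicNonface (2 * m + 1) m W ↔ ∀ k < 2 * m + 1, k ∈ W := by
  constructor
  · rintro ⟨⟨f, hf, hf'⟩, ⟨g, hg, hg'⟩⟩ j hj
    have hfk : ∀ k ≤ m, f k = 2 * k := fun k hk => by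
      have := separated_lower (fun k hk => (hf k hk).1) hf' k (by omega)
      have := separated_upper (fun k hk => (hf k hk).2.1) hf' (m - k) k (by omega)
      omega
    have hgk : ∀ k < m, g k = 2 * k + 1 := fun k hk => by
      have := separated_lower (fun k hk => (hg k hk).1) hg' k (by omega)
      have := separated_upper (fun k hk => (hg k hk).2.1) hg' (m - 1 - k) k (by omega)
      omega
    rcases Nat.even_or_odd' j with ⟨k, rfl | rfl⟩
    · rw [← hfk k (by omega)]; exact (hf k (by omega)).2.2
    · rw [← hgk k (by omega)]; exact (hg k (by omega)).2.2
  · intro h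
    refine ⟨⟨fun k => 2 * k, fun k hk => ?_, fun k hk => ?_⟩,
      ⟨fun k => 2 * k + 1, fun k hk => ?_, fun k hk => ?_⟩⟩ <;> dsimp only
    · exact ⟨Nat.zero_le _, by omega, h _ (by omega)⟩
    · omega
    · exact ⟨by omega, by omega, h _ (by omega)⟩
    · omega

end Separated

/-! ### Resolutions of separated and cyclic ideals. -/

section CyclicIdeals

open MvPolynomial

variable {K : Type u} [Field K] {ι : Type} (pos : ι → ℕ)

theorem monotone_hasSeparated (lo hi s : ℕ) :
    Monotone fun W : Set ι => HasSeparated lo hi s (pos '' W) :=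
  fun _ _ h hW => hW.mono le_rfl le_rfl (Set.image_mono h)

theorem monotone_isCyclicNonface (n m : ℕ) :
    Monotone fun W : Set ι => IsCyclicNonface n m (pos '' W) :=
  fun _ _ h hW => ⟨hW.1.mono le_rfl le_rfl (Set.image_mono h),
    hW.2.mono le_rfl le_rfl (Set.image_mono h)⟩

variable (K) in
/-- The ideal spanned by the monomials `x_F`, where `F` has `s` elements with positions in
`[lo, hi)`, no two of them consecutive. -/
noncomputable def separatedIdeal (lo hi s : ℕ) : Ideal (MvPolynomial ι K) :=
  supportIdeal K (monotone_hasSeparated pos lo hi s)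

variable (K) in
/-- The ideal spanned by the nonfaces of a cyclic polytope on the variables with positions
in `[0, n)`. -/
noncomputable def cyclicIdeal (n m : ℕ) : Ideal (MvPolynomial ι K) :=
  supportIdeal K (monotone_isCyclicNonface pos n m)

variable {pos}

theorem isGeneratedInDegree_separatedIdeal (lo hi s : ℕ) :
    IsGeneratedInDegree (variablesIdeal K ι) s (separatedIdeal K pos lo hi s) := by
  classical
  have key : ∀ W : Finset ι, HasSeparated lo hi s (pos '' (W : Set ι)) →
      ∃ F ⊆ W, F.card = s ∧ HasSeparated lo hi s (pos '' (F : Set ι)) := by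
    rintro W ⟨f, hf, hf'⟩
    have hex : ∀ k (_ : k < s), ∃ i ∈ W, pos i = f k := fun k hk => (hf k hk).2.2
    choose i hi using hex
    refine ⟨Finset.univ.image fun k : Fin s => i k k.2, ?_, ?_, f, fun k hk => ⟨(hf k hk).1, (hf k hk).2.1, ?_⟩, hf'⟩
    · intro x hx
      obtain ⟨k, -, rfl⟩ := Finset.mem_image.1 hx
      exact (hi k k.2).1
    · rw [Finset.card_image_of_injective, Finset.card_univ, Fintype.card_fin]
      have hlt : ∀ d a, a + d + 1 < s → f a < f (a + d + 1) := by
        intro d a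
        induction d with
        | zero => intro h; have := hf' a h; rw [add_zero]; omega
        | succ d ih =>
          intro h
          rw [← add_assoc] at h ⊢
          have := ih (by omega); have := hf' (a + d + 1) h; omega
      rintro ⟨a, ha⟩ ⟨b, hb⟩ hab
      have hfab : f a = f b := by rw [← (hi a ha).2, ← (hi b hb).2]; exact congrArg pos hab
      rw [Fin.mk.injEq]
      by_contra hne
      rcases Nat.lt_or_gt_of_ne hne with h | h
      · have := hlt (b - a - 1) a (by omega)
        rw [show a + (b - a - 1) + 1 = b by omega] at this
        omega
      · have := hlt (a - b - 1) b (by omega)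
        rw [show b + (a - b - 1) + 1 = a by omega] at this
        omega
    · exact ⟨i k hk, Finset.mem_coe.2
        (Finset.mem_image_of_mem (fun k : Fin s => i k k.2) (Finset.mem_univ ⟨k, hk⟩)), (hi k hk).2⟩
  refine isGeneratedInDegree_supportIdeal (fun W hW => ?_) key
  obtain ⟨F, hFW, hFs, -⟩ := key W hW
  exact hFs ▸ Finset.card_le_card hFW

theorem X_mul_mem_separatedIdeal_iff {lo hi s : ℕ} {j : ι} (hj : hi ≤ pos j)
    (f : MvPolynomial ι K) :
    X j * f ∈ separatedIdeal K pos lo hi s ↔ f ∈ separatedIdeal K pos lo hi s :=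
  X_mul_mem_supportIdeal_iff fun W hW =>
    HasSeparated.of_insert hj (by rwa [Set.image_insert_eq] at hW)

theorem separatedIdeal_succ (hpos : Function.Injective pos) {lo s : ℕ} {j : ι}
    (hlo : lo ≤ pos j) :
    separatedIdeal K pos lo (pos j + 1) (s + 1) =
      separatedIdeal K pos lo (pos j) (s + 1) ⊔
        Ideal.span {X j} * separatedIdeal K pos lo (pos j - 1) s := by
  refine supportIdeal_eq_sup (fun W => ?_) fun W hW => ?_
  · rw [hasSeparated_succ_iff hlo, hpos.mem_set_image]
  · rw [Set.image_insert_eq] at hW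
    exact hW.of_insert (Nat.sub_le _ _)

theorem cyclicIdeal_succ (hpos : Function.Injective pos) {m : ℕ} {j : ι}
    (hj : 2 * m + 1 ≤ pos j) :
    cyclicIdeal K pos (pos j + 1) m =
      separatedIdeal K pos 0 (pos j) (m + 1) ⊔
        Ideal.span {X j} * separatedIdeal K pos 1 (pos j - 1) m := by
  refine supportIdeal_eq_sup (fun W => ?_) fun W hW => ?_
  · rw [isCyclicNonface_succ_iff hj, hpos.mem_set_image]
  · rw [Set.image_insert_eq] at hW
    exact hW.of_insert (Nat.sub_le _ _)

theorem separatedIdeal_inf (n m : ℕ) :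
    separatedIdeal K pos 0 n (m + 1) ⊓ separatedIdeal K pos 1 (n - 1) m = cyclicIdeal K pos n m :=
  supportIdeal_inf _

theorem separatedIdeal_le (lo hi s : ℕ) :
    separatedIdeal K pos lo hi (s + 1) ≤ separatedIdeal K pos lo (hi - 1) s :=
  supportIdeal_mono fun _ hW => hW.pred

/-- The Betti numbers of the ideal `(x_1, …, x_c) ^ s`. -/
def powerBetti : ℕ → ℕ → ℕ → ℕ
  | _, 0 => Pi.single 0 1
  | 0, _ + 1 => 0
  | c + 1, s + 1 => powerBetti c (s + 1) + (powerBetti (c + 1) s + shiftSeq (powerBetti c (s + 1)))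

/-- The Betti numbers of the Stanley--Reisner ideal of the cyclic polytope with `2 m + 1 + p`
vertices in dimension `2 m`. -/
def cyclicBetti (m : ℕ) : ℕ → ℕ → ℕ
  | 0 => Pi.single 0 1
  | p + 1 => powerBetti (p + 1) (m + 1) + (powerBetti (p + 1) m + shiftSeq (cyclicBetti m p))

variable (P : ProjectiveResolution
  (ModuleCat.of (MvPolynomial ι K) (MvPolynomial ι K ⧸ variablesIdeal K ι)))

theorem X_mem_variablesIdeal (j : ι) : (X j : MvPolynomial ι K) ∈ variablesIdeal K ι :=
  Ideal.subset_span ⟨j, rfl⟩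

/-- For separated positions `f k`, the numbers `f k - lo - 2 * k` increase weakly and take `c = hi -
lo - 2 * s + 2` possible values. The generators thus match the monomials of degree `s` in `c`
variables, and splitting off the last position mirrors the recursion for powers. For `s = 0` the
ideal is the whole ring and any positive `c` works. -/
theorem separatedIdeal_resolution (hpos : Function.Injective pos) {v : ℕ}
    (hv : ∀ n < v, ∃ j, pos j = n) (lo s c hi : ℕ)
    (h : s = 0 ∧ 1 ≤ c ∨ 1 ≤ s ∧ hi + 2 = lo + c + 2 * s) (hhi : hi ≤ v) :
    DetectedByHead P.complex (variablesIdeal K ι)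
        (ModuleCat.of _ (separatedIdeal K pos lo hi s)) ∧
      HasBetti K P.complex (ModuleCat.of _ (separatedIdeal K pos lo hi s)) (powerBetti c s) ∧
      HasProjectiveDimensionLT
        (ModuleCat.of (MvPolynomial ι K) (separatedIdeal K pos lo hi s)) c := by
  induction s generalizing c hi with
  | zero =>
    have htop : separatedIdeal K pos lo hi 0 = ⊤ :=
      supportIdeal_eq_top fun _ => hasSeparated_zero
    rw [htop]
    let e : ModuleCat.of (MvPolynomial ι K) (MvPolynomial ι K) ≅
        ModuleCat.of _ (⊤ : Ideal (MvPolynomial ι K)) :=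
      (Submodule.topEquiv (R := MvPolynomial ι K)).symm.toModuleIso
    refine ⟨(detectedByHead_unit P).of_iso e, ?_, ?_⟩
    · rw [powerBetti]
      exact (hasBetti_unit P finrank_quotient_variablesIdeal).of_iso e
    · have := hasProjectiveDimensionLT_of_iso e 1
      exact hasProjectiveDimensionLT_of_ge _ 1 c (by omega)
  | succ s ihs =>
    induction c generalizing hi with
    | zero =>
      have hbot : separatedIdeal K pos lo hi (s + 1) = ⊥ :=
        supportIdeal_eq_bot fun _ => not_hasSeparated (by omega)
      rw [hbot]
      have h0 : Limits.IsZero (ModuleCat.of (MvPolynomial ι K) (⊥ : Ideal (MvPolynomial ι K))) :=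
        ModuleCat.isZero_of_subsingleton _
      refine ⟨.of_isZero h0, ?_, h0.hasProjectiveDimensionLT_zero⟩
      rw [powerBetti]
      exact .of_isZero h0
    | succ c ihc =>
      obtain ⟨n, rfl⟩ : ∃ n, hi = n + 1 := ⟨hi - 1, by omega⟩
      obtain ⟨j, rfl⟩ := hv n (by omega)
      obtain ⟨hA₁, hA₂, hA₃⟩ := ihc (pos j) (by omega) (by omega)
      obtain ⟨hB₁, hB₂, hB₃⟩ := ihs (c + 1) (pos j - 1) (by omega) (by omega)
      rw [separatedIdeal_succ hpos (by omega)]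
      have hgA := isGeneratedInDegree_separatedIdeal (K := K) (pos := pos) lo (pos j) (s + 1)
      have hgB := isGeneratedInDegree_separatedIdeal (K := K) (pos := pos) lo (pos j - 1) s
      have hinf : separatedIdeal K pos lo (pos j) (s + 1) ⊓ separatedIdeal K pos lo (pos j - 1) s =
          separatedIdeal K pos lo (pos j) (s + 1) := inf_eq_left.2 (separatedIdeal_le _ _ _)
      have hcol : ∀ b ∈ separatedIdeal K pos lo (pos j - 1) s,
          X j * b ∈ separatedIdeal K pos lo (pos j) (s + 1) ↔
            b ∈ separatedIdeal K pos lo (pos j) (s + 1) :=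
        fun b _ => X_mul_mem_separatedIdeal_iff le_rfl b
      refine ⟨.sup_span_mul P.projective exists_sub_C_mem_variablesIdeal hgA hgB
        (X_mem_variablesIdeal j) hcol (separatedIdeal_le _ _ _) hA₁ hB₁, ?_, ?_⟩
      · rw [powerBetti]
        exact .sup_span_mul P.projective exists_sub_C_mem_variablesIdeal hgA hgB
          (X_mem_variablesIdeal j) hcol hA₁ hB₁ hA₂ hB₂ (by rw [hinf]; exact hA₂)
      · exact hasProjectiveDimensionLT_sup_span_mul hcol c
          (hasProjectiveDimensionLT_of_ge _ c _ (Nat.le_succ c)) hB₃ (by rw [hinf]; exact hA₃)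

/-- The induction starts from the boundary of a simplex, whose ideal is principal. In the step both
separated ideals have parameter `c = p + 1`, and the intersection is the previous cyclic ideal. -/
theorem cyclicIdeal_resolution (hpos : Function.Injective pos) [Finite ι] {v : ℕ}
    (hv : ∀ n < v, ∃ j, pos j = n) (m p : ℕ) (hp : 2 * m + 1 + p ≤ v) :
    HasBetti K P.complex (ModuleCat.of _ (cyclicIdeal K pos (2 * m + 1 + p) m))
        (cyclicBetti m p) ∧
      HasProjectiveDimensionLT
        (ModuleCat.of (MvPolynomial ι K) (cyclicIdeal K pos (2 * m + 1 + p) m)) (p + 1) := by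
  classical
  have := Fintype.ofFinite ι
  induction p with
  | zero =>
    let F : Finset ι := {i | pos i < 2 * m + 1}
    have hspan : cyclicIdeal K pos (2 * m + 1 + 0) m = Ideal.span {∏ i ∈ F, X i} := by
      refine supportIdeal_eq_span_prod F fun W => ?_
      rw [add_zero, isCyclicNonface_base_iff]
      constructor
      · intro h i hi
        exact hpos.mem_set_image.1 (h _ (Finset.mem_filter.1 (Finset.mem_coe.1 hi)).2)
      · intro h k hk
        obtain ⟨j, rfl⟩ := hv k (by omega)
        exact ⟨j, h (Finset.mem_coe.2 (Finset.mem_filter.2 ⟨Finset.mem_univ _, hk⟩)), rfl⟩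
    rw [hspan]
    have hne : (∏ i ∈ F, X i : MvPolynomial ι K) ≠ 0 := Finset.prod_ne_zero_iff.2 fun i _ => X_ne_zero i
    let e : ModuleCat.of (MvPolynomial ι K) (MvPolynomial ι K) ≅
        ModuleCat.of _ (Ideal.span {(∏ i ∈ F, X i : MvPolynomial ι K)}) :=
      (LinearEquiv.toSpanNonzeroSingleton (MvPolynomial ι K) (MvPolynomial ι K) _ hne).toModuleIso
    exact ⟨(hasBetti_unit P finrank_quotient_variablesIdeal).of_iso e,
      hasProjectiveDimensionLT_of_iso e 1⟩
  | succ p ih =>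
    obtain ⟨hN₂, hN₃⟩ := ih (by omega)
    obtain ⟨j, hj⟩ := hv (2 * m + 1 + p) (by omega)
    rw [← hj] at hN₂ hN₃
    obtain ⟨hA₁, hA₂, hA₃⟩ := separatedIdeal_resolution P hpos hv 0 (m + 1) (p + 1) (pos j)
      (by omega) (by omega)
    obtain ⟨hB₁, hB₂, hB₃⟩ := separatedIdeal_resolution P hpos hv 1 m (p + 1) (pos j - 1)
      (by omega) (by omega)
    rw [← add_assoc, ← hj, cyclicIdeal_succ hpos (by omega)]
    have hcol : ∀ b ∈ separatedIdeal K pos 1 (pos j - 1) m,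
        X j * b ∈ separatedIdeal K pos 0 (pos j) (m + 1) ↔
          b ∈ separatedIdeal K pos 0 (pos j) (m + 1) :=
      fun b _ => X_mul_mem_separatedIdeal_iff le_rfl b
    refine ⟨.sup_span_mul P.projective exists_sub_C_mem_variablesIdeal
      (isGeneratedInDegree_separatedIdeal _ _ _) (isGeneratedInDegree_separatedIdeal _ _ _)
      (X_mem_variablesIdeal j) hcol hA₁ hB₁ hA₂ hB₂ (by rw [separatedIdeal_inf]; exact hN₂), ?_⟩
    exact hasProjectiveDimensionLT_sup_span_mul hcol (p + 1)
      (hasProjectiveDimensionLT_of_ge _ (p + 1) _ (Nat.le_succ _))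
      (hasProjectiveDimensionLT_of_ge _ (p + 1) _ (Nat.le_succ _))
      (by rw [separatedIdeal_inf]; exact hN₃)

end CyclicIdeals

/-! ### Simplicial complexes with the required face numbers. -/

section Complex

open Finset

/-- The vertices `(0, 0), …, (k - 1, 0)`. -/
def chain (k : ℕ) : Finset (ℕ × ℕ) := (range k).image fun j => (j, 0)

theorem mem_chain {k : ℕ} {x : ℕ × ℕ} : x ∈ chain k ↔ x.1 < k ∧ x.2 = 0 := by
  simp only [chain, mem_image, mem_range]
  exact ⟨by rintro ⟨j, hj, rfl⟩; exact ⟨hj, rfl⟩, fun h => ⟨x.1, h.1, Prod.ext rfl h.2.symm⟩⟩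

theorem card_chain (k : ℕ) : (chain k).card = k := by
  rw [chain, card_image_of_injective _ fun a b h => congrArg Prod.fst h, card_range]

/-- The faces joining one of the vertices `(k, e)`, `e < c`, to a subset of `chain k`. -/
def chainLayer (c k : ℕ) : Finset (Finset (ℕ × ℕ)) :=
  (range c ×ˢ (chain k).powerset).image fun q => insert (k, q.1) q.2

theorem mem_chainLayer {c k : ℕ} {F : Finset (ℕ × ℕ)} :
    F ∈ chainLayer c k ↔ ∃ e < c, ∃ σ ⊆ chain k, insert (k, e) σ = F := by
  simp only [chainLayer, mem_image, mem_product, mem_range, mem_powerset, Prod.exists]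
  exact ⟨fun ⟨e, σ, ⟨he, hσ⟩, h⟩ => ⟨e, he, σ, hσ, h⟩, fun ⟨e, he, σ, hσ, h⟩ => ⟨e, σ, ⟨he, hσ⟩, h⟩⟩

theorem notMem_of_subset_chain {k e : ℕ} {σ : Finset (ℕ × ℕ)} (hσ : σ ⊆ chain k) :
    (k, e) ∉ σ := fun h => (mem_chain.1 (hσ h)).1.false

theorem card_filter_chainLayer (c k i : ℕ) :
    #{F ∈ chainLayer c k | #F = i + 1} = c * k.choose i := by
  have h : (chainLayer c k).filter (fun F => #F = i + 1) =
      (range c ×ˢ (chain k).powersetCard i).image fun q => insert (k, q.1) q.2 := by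
    ext F
    simp only [mem_filter, mem_chainLayer, mem_image, mem_product, mem_range, mem_powersetCard,
      Prod.exists]
    constructor
    · rintro ⟨⟨e, he, σ, hσ, rfl⟩, hc⟩
      rw [card_insert_of_notMem (notMem_of_subset_chain hσ)] at hc
      exact ⟨e, σ, ⟨he, hσ, by omega⟩, rfl⟩
    · rintro ⟨e, σ, ⟨he, hσ, hc⟩, rfl⟩
      exact ⟨⟨e, he, σ, hσ, rfl⟩, by rw [card_insert_of_notMem (notMem_of_subset_chain hσ), hc]⟩
  rw [h, card_image_of_injOn, card_product, card_range, card_powersetCard, card_chain]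
  rintro ⟨e, σ⟩ h1 ⟨e', σ'⟩ h2 heq
  simp only [coe_product, Set.mem_prod, mem_coe, mem_powersetCard] at h1 h2
  dsimp only at heq
  have hee : e = e' := by
    have := heq ▸ mem_insert_self (k, e) σ
    rcases mem_insert.1 this with h | h
    · exact congrArg Prod.snd h
    · exact absurd h (notMem_of_subset_chain h2.2.1)
  subst hee
  rw [← erase_insert (notMem_of_subset_chain (e := e) h1.2.1), heq,
    erase_insert (notMem_of_subset_chain h2.2.1)]

/-- The simplicial complex with the faces `{(k, e)} ∪ σ`, where `k < p`, `e < c k` and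
`σ ⊆ chain k`. -/
def chainComplex (c : ℕ → ℕ) (p : ℕ) : Finset (Finset (ℕ × ℕ)) :=
  (range p).biUnion fun k => chainLayer (c k) k

theorem mem_chainComplex {c : ℕ → ℕ} {p : ℕ} {F : Finset (ℕ × ℕ)} :
    F ∈ chainComplex c p ↔ ∃ k < p, ∃ e < c k, ∃ σ ⊆ chain k, insert (k, e) σ = F := by
  simp only [chainComplex, mem_biUnion, mem_range, mem_chainLayer]

theorem card_filter_chainComplex (c : ℕ → ℕ) (p i : ℕ) :
    #{F ∈ chainComplex c p | #F = i + 1} = ∑ k ∈ range p, c k * k.choose i := by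
  rw [chainComplex, filter_biUnion, card_biUnion]
  · exact sum_congr rfl fun k _ => card_filter_chainLayer _ _ _
  · intro k _ l _ hkl
    refine disjoint_left.2 fun F h1 h2 => ?_
    obtain ⟨e, -, σ, hσ, rfl⟩ := mem_chainLayer.1 (mem_filter.1 h1).1
    obtain ⟨e', -, σ', hσ', heq⟩ := mem_chainLayer.1 (mem_filter.1 h2).1
    have h3 : (k, e) ∈ insert (l, e') σ' := heq ▸ mem_insert_self _ _
    have h4 : (l, e') ∈ insert (k, e) σ := heq ▸ mem_insert_self _ _
    rcases mem_insert.1 h3 with h3 | h3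
    · exact hkl (congrArg Prod.fst h3)
    rcases mem_insert.1 h4 with h4 | h4
    · exact hkl (congrArg Prod.fst h4).symm
    have := (mem_chain.1 (hσ' h3)).1
    have := (mem_chain.1 (hσ h4)).1
    dsimp only at *
    omega

/-- A subface that loses its top vertex lies in the chain. Its largest vertex `(l, 0)` then becomes
the top one, which is allowed because `0 < c l`. -/
theorem chainComplex_down_closed {c : ℕ → ℕ} (hc : ∀ k, 0 < c k) {p : ℕ}
    {F G : Finset (ℕ × ℕ)} (hF : F ∈ chainComplex c p) (hGF : G ⊆ F) (hG : G.Nonempty) :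
    G ∈ chainComplex c p := by
  obtain ⟨k, hk, e, he, σ, hσ, rfl⟩ := mem_chainComplex.1 hF
  by_cases hkG : (k, e) ∈ G
  · exact mem_chainComplex.2 ⟨k, hk, e, he, G.erase (k, e),
      (subset_insert_iff.1 hGF).trans hσ, insert_erase hkG⟩
  · have hGc : G ⊆ chain k := ((subset_insert_iff_of_notMem hkG).1 hGF).trans hσ
    obtain ⟨x, hx, hmax⟩ := exists_max_image G Prod.fst hG
    have hx' := mem_chain.1 (hGc hx)
    refine mem_chainComplex.2 ⟨x.1, by omega, x.2, hx'.2 ▸ hc _, G.erase x, fun y hy => ?_,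
      insert_erase hx⟩
    have hy' := mem_chain.1 (hGc (mem_of_mem_erase hy))
    have hle := hmax y (mem_of_mem_erase hy)
    refine mem_chain.2 ⟨lt_of_le_of_ne hle fun h => ne_of_mem_erase hy ?_, hy'.2⟩
    exact Prod.ext h (hy'.2.trans hx'.2.symm)

/-- The relabelling `(0, 1) ↦ (0, 0)`, and `(k, e) ↦ (k + 1, e)` for the other vertices. -/
def shiftVertex : ℕ × ℕ ↪ ℕ × ℕ where
  toFun x := if x = (0, 1) then (0, 0) else (x.1 + 1, x.2)
  inj' := by
    rintro ⟨a, b⟩ ⟨a', b'⟩ h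
    dsimp only at h
    split_ifs at h with h1 h2 h2
    · rw [h1, h2]
    · simp at h
    · simp at h
    · simpa using h

theorem shiftVertex_apply_apex : shiftVertex (0, 1) = (0, 0) := rfl

theorem shiftVertex_apply {x : ℕ × ℕ} (hx : x ≠ (0, 1)) : shiftVertex x = (x.1 + 1, x.2) :=
  if_neg hx

theorem shiftVertex_ne (x : ℕ × ℕ) : shiftVertex x ≠ (0, 1) := by
  by_cases hx : x = (0, 1)
  · subst hx; simp [shiftVertex_apply_apex]
  · simp [shiftVertex_apply hx]

theorem apex_notMem_map (F : Finset (ℕ × ℕ)) : (0, 1) ∉ F.map shiftVertex := fun h => by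
  obtain ⟨x, -, hx⟩ := mem_map.1 h
  exact shiftVertex_ne x hx

theorem map_shiftVertex_subset_chain {k : ℕ} {σ : Finset (ℕ × ℕ)} (hσ : σ ⊆ chain k) :
    σ.map shiftVertex ⊆ chain (k + 1) := by
  intro y hy
  obtain ⟨x, hx, rfl⟩ := mem_map.1 hy
  have hx' := mem_chain.1 (hσ hx)
  rw [shiftVertex_apply (by rintro rfl; exact one_ne_zero hx'.2)]
  exact mem_chain.2 ⟨by dsimp only; omega, hx'.2⟩

/-- The complexes obtained from a point by repeatedly adding `chainComplex c (p + 1)` and coning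
over the previous complex, embedded in it, from the isolated vertex `(0, 1)`. -/
def apexComplex (c : ℕ → ℕ) : ℕ → Finset (Finset (ℕ × ℕ))
  | 0 => {{(0, 1)}}
  | p + 1 => chainComplex c (p + 1) ∪
      (apexComplex c p).image fun F => insert (0, 1) (F.map shiftVertex)

variable {c : ℕ → ℕ}

theorem map_shiftVertex_insert (hc : Monotone c) {k e p : ℕ} (hk : k < p) (he : e < c k)
    {σ τ : Finset (ℕ × ℕ)} (hσ : σ ⊆ chain k) (hke : (k, e) ≠ (0, 1)) (hτ : τ ⊆ chain (k + 1)) :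
    (insert (k, e) σ).map shiftVertex ∪ τ ∈ chainComplex c (p + 1) := by
  rw [map_insert, shiftVertex_apply hke, insert_union]
  exact mem_chainComplex.2 ⟨k + 1, by omega, e, he.trans_le (hc (Nat.le_succ k)), _,
    union_subset (map_shiftVertex_subset_chain hσ) hτ, rfl⟩

/-- Monotonicity of `c` leaves room to move `(k, e)` up to `(k + 1, e)`, and this frees `(0, 0)` for
the old apex. The base of the new cone is therefore already part of the complex. -/
theorem map_shiftVertex_mem (hc : Monotone c) (hc0 : c 0 = 2) {p : ℕ} {F : Finset (ℕ × ℕ)}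
    (hF : F ∈ apexComplex c p) : F.map shiftVertex ∈ chainComplex c (p + 1) := by
  have hsing : ∀ q, {(0, 0)} ∈ chainComplex c (q + 1) := fun q =>
    mem_chainComplex.2 ⟨0, by omega, 0, by omega, ∅, empty_subset _, rfl⟩
  induction p generalizing F with
  | zero =>
    rw [mem_singleton.1 hF, map_singleton]
    exact hsing 0
  | succ p ih =>
    rcases mem_union.1 hF with hF | hF
    · obtain ⟨k, hk, e, he, σ, hσ, rfl⟩ := mem_chainComplex.1 hF
      by_cases hke : (k, e) = (0, 1)
      · obtain ⟨rfl, rfl⟩ := Prod.mk.injEq _ _ _ _ ▸ hke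
        rw [subset_empty.1 (hσ : σ ⊆ ∅)]
        exact hsing (p + 1)
      · have := map_shiftVertex_insert hc hk he hσ hke (empty_subset _)
        rwa [union_empty] at this
    · obtain ⟨F', hF', rfl⟩ := mem_image.1 hF
      obtain ⟨k, hk, e, he, σ, hσ, heq⟩ := mem_chainComplex.1 (ih hF')
      have hke : (k, e) ≠ (0, 1) := fun h =>
        apex_notMem_map F' (heq ▸ h ▸ mem_insert_self (k, e) σ)
      have h0 : {(0, 0)} ⊆ chain (k + 1) := singleton_subset_iff.2 (mem_chain.2 ⟨k.succ_pos, rfl⟩)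
      have := map_shiftVertex_insert hc hk he hσ hke h0
      rw [map_insert, ← heq, shiftVertex_apply_apex, insert_eq, union_comm]
      exact this

theorem nonempty_of_mem_apexComplex {p : ℕ} {F : Finset (ℕ × ℕ)} (hF : F ∈ apexComplex c p) :
    F.Nonempty := by
  cases p with
  | zero => rw [mem_singleton.1 hF]; exact singleton_nonempty _
  | succ p =>
    rcases mem_union.1 hF with hF | hF
    · obtain ⟨k, -, e, -, σ, -, rfl⟩ := mem_chainComplex.1 hF
      exact insert_nonempty _ _
    · obtain ⟨F', -, rfl⟩ := mem_image.1 hF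
      exact insert_nonempty _ _

theorem apexComplex_down_closed (hc : Monotone c) (hc0 : c 0 = 2) {p : ℕ} {F G : Finset (ℕ × ℕ)}
    (hF : F ∈ apexComplex c p) (hGF : G ⊆ F) (hG : G.Nonempty) : G ∈ apexComplex c p := by
  have hpos : ∀ k, 0 < c k := fun k => by have := hc (Nat.zero_le k); omega
  induction p generalizing F G with
  | zero =>
    have := mem_singleton.1 hF
    subst this
    exact mem_singleton.2 ((subset_singleton_iff.1 hGF).resolve_left hG.ne_empty)
  | succ p ih =>
    rcases mem_union.1 hF with hF | hF
    · exact mem_union_left _ (chainComplex_down_closed hpos hF hGF hG)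
    · obtain ⟨F', hF', rfl⟩ := mem_image.1 hF
      by_cases hy : (0, 1) ∈ G
      · obtain ⟨G', hG'F', hG'⟩ := subset_map_iff.1 (subset_insert_iff.1 hGF)
        rcases G'.eq_empty_or_nonempty with rfl | hne
        -- The apex alone is a vertex of the chain complex, since `c 0 = 2`.
        · refine mem_union_left _ (mem_chainComplex.2
            ⟨0, by omega, 1, by omega, ∅, empty_subset _, ?_⟩)
          rw [map_empty] at hG'
          rw [← insert_erase hy, hG']
        · refine mem_union_right _ (mem_image.2 ⟨G', ih hF' hG'F' hne, ?_⟩)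
          rw [← hG', insert_erase hy]
      · exact mem_union_left _ (chainComplex_down_closed hpos (map_shiftVertex_mem hc hc0 hF')
          ((subset_insert_iff_of_notMem hy).1 hGF) hG)

theorem card_insert_map (F : Finset (ℕ × ℕ)) :
    #(insert (0, 1) (F.map shiftVertex)) = #F + 1 := by
  rw [card_insert_of_notMem (apex_notMem_map F), card_map]

theorem insert_map_injective :
    Function.Injective fun F : Finset (ℕ × ℕ) => insert (0, 1) (F.map shiftVertex) := by
  intro F G h
  dsimp only at h
  refine map_injective shiftVertex ?_
  rw [← erase_insert (apex_notMem_map F), h, erase_insert (apex_notMem_map G)]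

/-- Coning adds one element to each face. The two families are disjoint because `(0, 1)` is isolated
in the chain complex, while every cone face joins it to a nonempty face. -/
theorem card_filter_apexComplex_succ (p i : ℕ) :
    #{F ∈ apexComplex c (p + 1) | #F = i + 1} =
      ∑ k ∈ range (p + 1), c k * k.choose i + #{F ∈ apexComplex c p | #F = i} := by
  rw [apexComplex, filter_union, card_union_of_disjoint, card_filter_chainComplex, filter_image,
    card_image_of_injective _ insert_map_injective]
  · simp only [card_insert_map, Nat.add_right_cancel_iff]
  · refine disjoint_left.2 fun F h1 h2 => ?_
    obtain ⟨F', hF', rfl⟩ := mem_image.1 (mem_filter.1 h2).1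
    obtain ⟨k, -, e, -, σ, hσ, heq⟩ := mem_chainComplex.1 (mem_filter.1 h1).1
    rcases mem_insert.1 (heq ▸ mem_insert_self (0, 1) (F'.map shiftVertex)) with h | h
    · obtain ⟨rfl, rfl⟩ := Prod.mk.injEq _ _ _ _ ▸ h
      rw [subset_empty.1 (hσ : σ ⊆ ∅)] at heq
      have h1 := congrArg card heq
      rw [card_insert_map, insert_empty_eq, card_singleton] at h1
      have := (nonempty_of_mem_apexComplex hF').card_pos
      omega
    · exact one_ne_zero (mem_chain.1 (hσ h)).2

theorem card_le_of_mem_apexComplex {p : ℕ} {F : Finset (ℕ × ℕ)} (hF : F ∈ apexComplex c p) :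
    #F ≤ p + 1 := by
  induction p generalizing F with
  | zero => rw [mem_singleton.1 hF]; rfl
  | succ p ih =>
    rcases mem_union.1 hF with hF | hF
    · obtain ⟨k, hk, e, -, σ, hσ, rfl⟩ := mem_chainComplex.1 hF
      have := card_le_card hσ
      rw [card_chain] at this
      have := card_insert_le (k, e) σ
      omega
    · obtain ⟨F', hF', rfl⟩ := mem_image.1 hF
      rw [card_insert_map]
      have := ih hF'
      omega

theorem exists_mem_apexComplex (p : ℕ) : ∃ F ∈ apexComplex c p, #F = p + 1 := by
  induction p with
  | zero => exact ⟨{(0, 1)}, mem_singleton_self _, rfl⟩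
  | succ p ih =>
    obtain ⟨F, hF, hFc⟩ := ih
    exact ⟨_, mem_union_right _ (mem_image_of_mem _ hF), by rw [card_insert_map, hFc]⟩

/-- A finite family of finite sets that is closed under passing to nonempty subsets
is a simplicial complex on finitely many points. -/
theorem exists_isFVector {α : Type*} [DecidableEq α] (𝓕 : Finset (Finset α))
    (hne : ∀ F ∈ 𝓕, F.Nonempty) (hdown : ∀ F ∈ 𝓕, ∀ G ⊆ F, G.Nonempty → G ∈ 𝓕) (p : ℕ)
    (hle : ∀ F ∈ 𝓕, #F ≤ p + 1) (hex : ∃ F ∈ 𝓕, #F = p + 1) :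
    ∃ (n : ℕ) (Γ : PreAbstractSimplicialComplex (Fin n)),
      IsFVector Γ fun i : Fin (p + 1) => #{F ∈ 𝓕 | #F = (i : ℕ) + 1} := by
  let X := 𝓕.biUnion id
  let emb : Fin #X ↪ α := X.equivFin.symm.toEmbedding.trans (Function.Embedding.subtype _)
  have hmap : ∀ F ∈ 𝓕, ∃ s : Finset (Fin #X), s.map emb = F := by
    intro F hF
    have hFX : F ⊆ univ.map emb := fun x hx => by
      have hxX : x ∈ X := mem_biUnion.2 ⟨F, hF, hx⟩
      exact mem_map.2 ⟨X.equivFin ⟨x, hxX⟩, mem_univ _, by simp [emb]⟩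
    obtain ⟨s, -, hs⟩ := subset_map_iff.1 hFX
    exact ⟨s, hs.symm⟩
  refine ⟨#X, ⟨{s | s.map emb ∈ 𝓕}, ?_⟩, ⟨?_, ?_⟩, ?_⟩
  · intro s hs
    refine ⟨(map_nonempty).1 (hne _ hs), fun t hts ht => ?_⟩
    exact hdown _ hs _ (map_subset_map.2 hts) (ht.map)
  · obtain ⟨F, hF, hFc⟩ := hex
    obtain ⟨s, rfl⟩ := hmap F hF
    exact ⟨s, hF, by rwa [card_map] at hFc⟩
  · rintro k ⟨s, hs, hsk⟩
    have := hle _ hs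
    rw [card_map] at this
    omega
  · intro i
    rw [faceCount, ← Set.ncard_image_of_injective _ (map_injective emb)]
    refine (Set.ncard_coe_finset _).symm.trans (congrArg Set.ncard ?_)
    ext F
    simp only [coe_filter, Set.mem_ofPred_eq, Set.mem_image]
    constructor
    · rintro ⟨hF, hFc⟩
      obtain ⟨s, rfl⟩ := hmap F hF
      exact ⟨s, ⟨hF, by rwa [card_map] at hFc⟩, rfl⟩
    · rintro ⟨s, ⟨hs, hsc⟩, rfl⟩
      exact ⟨hs, by rwa [card_map]⟩

end Complex

/-! ### Betti numbers as face numbers. -/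

section BettiNumbers

open Finset

/-- The number of monomials of degree `s` in `x_0, …, x_k` that are divisible by `x_k`, or equal
to `1` if `k = 0`. -/
def lastVariableCount : ℕ → ℕ → ℕ
  | k, 0 => if k = 0 then 1 else 0
  | 0, _ + 1 => 1
  | k + 1, s + 1 => lastVariableCount k (s + 1) + lastVariableCount (k + 1) s

theorem lastVariableCount_zero (s : ℕ) : lastVariableCount 0 s = 1 := by
  cases s <;> simp [lastVariableCount]

/-- This is the Eliahou–Kervaire formula for a power of the variables: a generator with last
variable `x_k` contributes `k.choose i`. In the recursion, Pascal's rule merges a sequence with its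
shift. -/
theorem powerBetti_eq (c s i : ℕ) (h : 1 ≤ c ∨ 1 ≤ s) :
    powerBetti c s i = ∑ k ∈ range c, lastVariableCount k s * k.choose i := by
  induction s generalizing c i with
  | zero =>
    obtain ⟨c, rfl⟩ := Nat.exists_eq_succ_of_ne_zero (by omega : c ≠ 0)
    rw [powerBetti, sum_range_succ', sum_eq_zero (fun k _ => by simp [lastVariableCount])]
    cases i <;> simp [lastVariableCount]
  | succ s ihs =>
    induction c generalizing i with
    | zero => rw [powerBetti, range_zero, sum_empty]; rfl
    | succ c ihc =>
      have hshift : shiftSeq (powerBetti c (s + 1)) i + powerBetti c (s + 1) i =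
          ∑ k ∈ range c, lastVariableCount k (s + 1) * (k + 1).choose i := by
        cases i with
        | zero => rw [shiftSeq, zero_add, ihc _ (by omega)]; simp
        | succ i =>
          rw [shiftSeq, ihc _ (by omega), ihc _ (by omega), ← sum_add_distrib]
          exact sum_congr rfl fun k _ => by rw [Nat.choose_succ_succ, mul_add]
      rw [powerBetti, Pi.add_apply, Pi.add_apply, ihs _ _ (by omega), sum_range_succ',
        sum_range_succ' (fun k => lastVariableCount k (s + 1) * k.choose i)]
      simp only [lastVariableCount, lastVariableCount_zero, add_mul, sum_add_distrib]
      rw [← hshift]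
      ring

/-- Positive degree is essential: in degree `0` the sequence is `1, 0, 0, …`. -/
theorem monotone_lastVariableCount (s : ℕ) : Monotone fun k => lastVariableCount k (s + 1) :=
  monotone_nat_of_le_succ fun k => by
    rw [lastVariableCount]
    exact Nat.le_add_right _ _

theorem cyclicBetti_eq_card (m p i : ℕ) :
    cyclicBetti (m + 1) p i = #{F ∈ apexComplex
      (fun k => lastVariableCount k (m + 2) + lastVariableCount k (m + 1)) p | #F = i + 1} := by
  induction p generalizing i with
  | zero =>
    rw [cyclicBetti, apexComplex, filter_singleton]
    cases i <;> simp
  | succ p ih =>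
    have hshift : shiftSeq (cyclicBetti (m + 1) p) i = #{F ∈ apexComplex
        (fun k => lastVariableCount k (m + 2) + lastVariableCount k (m + 1)) p | #F = i} := by
      cases i with
      | zero =>
        refine (card_eq_zero.2 (filter_eq_empty_iff.2 fun F hF h => ?_)).symm
        exact (nonempty_of_mem_apexComplex hF).ne_empty (card_eq_zero.1 h)
      | succ i => exact ih i
    rw [card_filter_apexComplex_succ, cyclicBetti, Pi.add_apply, Pi.add_apply, hshift,
      powerBetti_eq _ _ _ (by omega), powerBetti_eq _ _ _ (by omega)]
    simp only [add_mul, sum_add_distrib, add_assoc]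

theorem cyclicBetti_self_pos (m p : ℕ) : 0 < cyclicBetti m p p := by
  induction p with
  | zero => exact one_pos
  | succ p ih =>
    rw [cyclicBetti, Pi.add_apply, Pi.add_apply]
    exact lt_of_lt_of_le ih (by change cyclicBetti m p p ≤ _ + (_ + cyclicBetti m p p); omega)

theorem exists_isFVector_cyclicBetti (m p : ℕ) :
    ∃ (n : ℕ) (Γ : PreAbstractSimplicialComplex (Fin n)),
      IsFVector Γ fun i : Fin (p + 1) => cyclicBetti (m + 1) p i := by
  have hc : Monotone fun k => lastVariableCount k (m + 2) + lastVariableCount k (m + 1) :=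
    (monotone_lastVariableCount (m + 1)).add (monotone_lastVariableCount m)
  have hc0 : lastVariableCount 0 (m + 2) + lastVariableCount 0 (m + 1) = 2 := by
    rw [lastVariableCount_zero, lastVariableCount_zero]
  simp only [cyclicBetti_eq_card]
  exact exists_isFVector _ (fun F => nonempty_of_mem_apexComplex)
    (fun F hF G hGF hG => apexComplex_down_closed hc hc0 hF hGF hG) p
    (fun F => card_le_of_mem_apexComplex) (exists_mem_apexComplex p)

end BettiNumbers

/-! ### Polynomials nonnegative on alternating nodes. -/

section Alternation

open Polynomial

theorem sign_prod_sub {x : ℕ → ℝ} {N : ℕ} (hx : ∀ i j, i < j → j < N → x i < x j) {j : ℕ}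
    (hj : j < N) : 0 < (-1) ^ (j + N + 1) * ∏ i ∈ (Finset.range N).erase j, (x j - x i) := by
  induction N with
  | zero => omega
  | succ N ih =>
    rcases (Nat.lt_succ_iff.1 hj).lt_or_eq with h | rfl
    · have hN : N ∉ (Finset.range N).erase j := by simp
      rw [Finset.range_add_one, Finset.erase_insert_of_ne h.ne', Finset.prod_insert hN]
      have h1 := ih (fun i j hij hj => hx i j hij (by omega)) h
      have h2 := hx j N h (Nat.lt_succ_self N)
      have h3 := mul_pos (sub_pos.2 h2) h1
      exact h3.trans_eq (by ring)
    · have h1 : (Finset.range (j + 1)).erase j = Finset.range j := by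
        rw [Finset.range_add_one, Finset.erase_insert Finset.notMem_range_self]
      rw [h1, show j + (j + 1) + 1 = 2 * (j + 1) by ring, pow_mul, neg_one_sq, one_pow, one_mul]
      exact Finset.prod_pos fun i hi =>
        sub_pos.2 (hx i j (Finset.mem_range.1 hi) (Nat.lt_succ_self j))

/-- A polynomial of degree at most `2 m` that is nonnegative at `2 m + 2` points and vanishes at
every second of them is zero. -/
theorem eq_zero_of_alternating {m : ℕ} {q : ℝ[X]} (hq : q.natDegree ≤ 2 * m) {x : ℕ → ℝ}
    (hx : ∀ i j, i < j → j < 2 * m + 2 → x i < x j) (ε : ℕ)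
    (h0 : ∀ j < 2 * m + 2, (j + ε) % 2 = 0 → q.eval (x j) = 0)
    (h1 : ∀ j < 2 * m + 2, 0 ≤ q.eval (x j)) : q = 0 := by
  have hinj : Set.InjOn x (Finset.range (2 * m + 2)) := by
    intro i hi j hj hij
    have hi' := Finset.mem_range.1 (Finset.mem_coe.1 hi)
    have hj' := Finset.mem_range.1 (Finset.mem_coe.1 hj)
    by_contra hne
    rcases Nat.lt_or_gt_of_ne hne with h | h
    · exact (hx i j h hj').ne hij
    · exact (hx j i h hi').ne hij.symm
  have hdeg : q.degree < (Finset.range (2 * m + 2)).card := by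
    rw [Finset.card_range]
    exact lt_of_le_of_lt degree_le_natDegree (by exact_mod_cast (by omega))
  -- The coefficient of degree `2 * m + 1`, a divided difference over the nodes, is zero. Its
  -- denominators alternate in sign and every second value vanishes, so the remaining terms share
  -- one sign and must all be zero.
  have hsum := Lagrange.coeff_eq_sum hinj hdeg
  rw [Finset.card_range, coeff_eq_zero_of_natDegree_lt (by omega)] at hsum
  have hzero : ∀ j < 2 * m + 2, q.eval (x j) = 0 := by
    have hD := fun j (hj : j < 2 * m + 2) => sign_prod_sub hx hj
    have hnonneg : ∀ j ∈ Finset.range (2 * m + 2), 0 ≤ (-1) ^ ε *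
        (q.eval (x j) / ∏ i ∈ (Finset.range (2 * m + 2)).erase j, (x j - x i)) := by
      intro j hj
      have hj' := Finset.mem_range.1 hj
      by_cases hjε : (j + ε) % 2 = 0
      · rw [h0 j hj' hjε, zero_div, mul_zero]
      · have hpow : ((-1) ^ (j + (2 * m + 2) + 1) : ℝ) = (-1) ^ ε := by
          rcases Nat.even_or_odd ε with h | h
          · have : Even (j + (2 * m + 2) + 1) := by rw [Nat.even_iff] at h ⊢; omega
            rw [h.neg_one_pow, this.neg_one_pow]
          · have : Odd (j + (2 * m + 2) + 1) := by rw [Nat.odd_iff] at h ⊢; omega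
            rw [h.neg_one_pow, this.neg_one_pow]
        have hDj := hD j hj'
        rw [hpow] at hDj
        rcases neg_one_pow_eq_or ℝ ε with h | h <;> rw [h] at hDj ⊢
        · rw [one_mul] at hDj ⊢
          exact div_nonneg (h1 j hj') hDj.le
        · have := div_nonneg (h1 j hj') hDj.le
          rwa [neg_one_mul, div_neg, ← neg_one_mul] at this
    rw [eq_comm, ← mul_eq_zero_iff_left (pow_ne_zero ε (neg_ne_zero.2 one_ne_zero) : (-1 : ℝ) ^ ε ≠ 0),
      Finset.mul_sum, Finset.sum_eq_zero_iff_of_nonneg hnonneg] at hsum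
    intro j hj
    have hj0 := hsum j (Finset.mem_range.2 hj)
    have hDne := right_ne_zero_of_mul (hD j hj).ne'
    have hpne : (-1 : ℝ) ^ ε ≠ 0 := pow_ne_zero ε (neg_ne_zero.2 one_ne_zero)
    exact (div_eq_zero_iff.1 ((mul_eq_zero.1 hj0).resolve_left hpne)).resolve_right hDne
  refine Polynomial.eq_zero_of_degree_lt_of_eval_index_eq_zero _ hinj hdeg fun j hj => ?_
  exact hzero j (Finset.mem_range.1 hj)

end Alternation

/-! ### Gale's criterion for faces of cyclic polytopes. -/

section CyclicPolytope

open Polynomial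

variable {v : ℕ} {t : Fin v → ℝ} {pos : Fin v → ℕ}

/-- Each chosen position is paired with its right neighbour if `δ = 0` and its left neighbour if `δ
= 1`. Separation makes the resulting `2 * m + 2` nodes strictly increasing, and the polynomial
vanishes at every second one. -/
theorem eq_zero_of_hasSeparated (hinj : Function.Injective pos)
    (hpos : ∀ i j, pos i < pos j → t i < t j) (hv : ∀ n < v, ∃ j, pos j = n) {m : ℕ} {q : ℝ[X]} (hq : q.natDegree ≤ 2 * m)
    (hnonneg : ∀ i, 0 ≤ q.eval (t i)) {F : Set (Fin v)} (hF : ∀ i ∈ F, q.eval (t i) = 0)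
    {δ : ℕ} (hδ : δ ≤ 1) (h : HasSeparated δ (v - 1 + δ) (m + 1) (pos '' F)) (hv0 : 0 < v) :
    q = 0 := by
  obtain ⟨f, hf, hf'⟩ := h
  have : Nonempty (Fin v) := ⟨⟨0, hv0⟩⟩
  choose! node hnode using hv
  let N : ℕ → ℕ := fun j => f (j / 2) + j % 2 - δ
  have hN : ∀ j < 2 * m + 2, N j < v := fun j hj => by
    have := hf (j / 2) (by omega)
    simp only [N]; omega
  have hNstep : ∀ j, j + 1 < 2 * m + 2 → N j < N (j + 1) := fun j hj => by
    have h1 := hf (j / 2) (by omega)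
    simp only [N]
    rcases Nat.mod_two_eq_zero_or_one j with h | h
    · rw [show (j + 1) / 2 = j / 2 by omega]; omega
    · have := hf' (j / 2) (by omega)
      rw [show (j + 1) / 2 = j / 2 + 1 by omega]; omega
  have hNlt : ∀ d i, i + d + 1 < 2 * m + 2 → N i < N (i + d + 1) := by
    intro d i
    induction d with
    | zero => intro h; exact hNstep i h
    | succ d ih => intro h; exact (ih (by omega)).trans (hNstep (i + d + 1) h)
  refine eq_zero_of_alternating hq (x := fun j => t (node (N j))) (fun i j hij hj => ?_) δ
    (fun j hj hjδ => ?_) fun j _ => hnonneg _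
  · refine hpos _ _ ?_
    rw [hnode _ (hN i (by omega)), hnode _ (hN j hj)]
    have := hNlt (j - i - 1) i (by omega)
    rwa [show i + (j - i - 1) + 1 = j by omega] at this
  · obtain ⟨i, hi, hi'⟩ := (hf (j / 2) (by omega)).2.2
    have hlo := (hf (j / 2) (by omega)).1
    have hij : pos i = N j := by simp only [N]; omega
    have hnj : node (N j) = i := hinj ((hnode _ (hN j hj)).trans hij.symm)
    rw [hnj]; exact hF i hi

/-- Beyond the base case, a nonface has `m + 1` separated positions avoiding the last vertex or
avoiding the first, so neighbours exist on one side. With `2 * m + 1` vertices, every parameter is a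
root. -/
theorem eq_zero_of_isCyclicNonface (hinj : Function.Injective pos) (hlt : ∀ i, pos i < v)
    (hpos : ∀ i j, pos i < pos j → t i < t j) (hv : ∀ n < v, ∃ j, pos j = n)
    (ht : Function.Injective t) {m : ℕ} (hm : 2 * m + 1 ≤ v)
    {q : ℝ[X]} (hq : q.natDegree ≤ 2 * m) (hnonneg : ∀ i, 0 ≤ q.eval (t i))
    {F : Set (Fin v)} (hF : ∀ i ∈ F, q.eval (t i) = 0)
    (h : IsCyclicNonface v m (pos '' F)) : q = 0 := by
  rcases hm.lt_or_eq with hm' | rfl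
  · obtain ⟨n, rfl⟩ : ∃ n, v = n + 1 := ⟨v - 1, by omega⟩
    rcases (isCyclicNonface_succ_iff (by omega)).1 h with h | h
    · exact eq_zero_of_hasSeparated hinj hpos hv hq hnonneg hF zero_le_one h (by omega)
    · exact eq_zero_of_hasSeparated hinj hpos hv hq hnonneg hF le_rfl
        ((hasSeparated_succ_iff (by omega : 1 ≤ n)).2 (Or.inr h)) (by omega)
  · refine eq_zero_of_natDegree_lt_card_of_eval_eq_zero q ht (fun i => hF i ?_)
      (by rw [Fintype.card_fin]; omega)
    exact hinj.mem_set_image.1 (isCyclicNonface_base_iff.1 h _ (hlt i))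

/-- A set of positions without `s + 1` pairwise nonconsecutive elements is the zero set of
a nonnegative product of `s` quadratic polynomials. -/
theorem exists_polynomial_of_not_hasSeparated (hinj : Function.Injective pos)
    (hlt : ∀ i, pos i < v) (hpos : ∀ i j, pos i < pos j → t i < t j)
    (hv : ∀ n < v, ∃ j, pos j = n) {hi : ℕ} {F : Set (Fin v)} (s lo : ℕ)
    (h : ¬ HasSeparated lo hi (s + 1) (pos '' F)) :
    ∃ q : ℝ[X], q ≠ 0 ∧ q.natDegree ≤ 2 * s ∧ (∀ i, 0 ≤ q.eval (t i)) ∧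
      ∀ i ∈ F, lo ≤ pos i → pos i < hi → q.eval (t i) = 0 := by
  classical
  by_cases hex : ∃ w, lo ≤ w ∧ w < hi ∧ w ∈ pos '' F
  swap
  · exact ⟨1, one_ne_zero, by simp, fun i => by simp,
      fun i hiF h1 h2 => absurd ⟨_, h1, h2, i, hiF, rfl⟩ hex⟩
  have hmin := fun k => Nat.find_min hex (m := k)
  obtain ⟨hw1, hw2, a, haF, haw⟩ := Nat.find_spec hex
  set w := Nat.find hex
  have hle : ∀ i j, pos i ≤ pos j → t i ≤ t j := fun i j hij =>
    hij.lt_or_eq.elim (fun h => (hpos i j h).le) fun h => (congrArg t (hinj h)).le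
  have hge : ∀ i ∈ F, lo ≤ pos i → pos i < hi → w ≤ pos i := fun i hiF h1 h2 =>
    not_lt.1 fun hlt => hmin _ hlt ⟨h1, h2, i, hiF, rfl⟩
  cases s with
  | zero =>
    refine absurd ⟨fun _ => w, fun k _ => ⟨hw1, hw2, a, haF, haw⟩, fun k hk => ?_⟩ h
    omega
  | succ s =>
    -- Otherwise the least position `w` could be prepended.
    have h' : ¬ HasSeparated (w + 2) hi (s + 1) (pos '' F) := by
      rintro ⟨f, hf, hf'⟩
      refine h ⟨fun k => if k = 0 then w else f (k - 1), fun k hk => ?_, fun k hk => ?_⟩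
      · dsimp only
        split_ifs with hk0
        · exact ⟨hw1, hw2, a, haF, haw⟩
        · have := hf (k - 1) (by omega)
          exact ⟨by omega, this.2⟩
      · dsimp only
        rw [if_neg (Nat.succ_ne_zero k), Nat.add_sub_cancel]
        split_ifs with hk0
        · exact (hf k (by omega)).1
        · have := hf' (k - 1) (by omega)
          rwa [Nat.sub_add_cancel (by omega)] at this
    obtain ⟨q, hq0, hqd, hqn, hqz⟩ :=
      exists_polynomial_of_not_hasSeparated hinj hlt hpos hv s (w + 2) h'
    -- The quadratic factor has roots at two neighbouring parameters, so it is nonnegative at all of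
    -- them. If `w` is the last position, a double root is used.
    obtain ⟨b, hb⟩ : ∃ b, pos b = w + 1 ∨ (b = a ∧ v = w + 1) := by
      by_cases hwv : w + 1 < v
      · obtain ⟨b, hb⟩ := hv _ hwv
        exact ⟨b, Or.inl hb⟩
      · have := hlt a
        exact ⟨a, Or.inr ⟨rfl, by omega⟩⟩
    refine ⟨(X - C (t a)) * (X - C (t b)) * q, ?_, ?_, fun i => ?_, fun i hiF h1 h2 => ?_⟩
    · exact mul_ne_zero (mul_ne_zero (X_sub_C_ne_zero _) (X_sub_C_ne_zero _)) hq0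
    · refine natDegree_mul_le.trans ?_
      have := natDegree_mul_le (p := X - C (t a)) (q := X - C (t b))
      rw [natDegree_X_sub_C, natDegree_X_sub_C] at this
      omega
    · rw [eval_mul, eval_mul]
      refine mul_nonneg ?_ (hqn i)
      simp only [eval_sub, eval_X, eval_C]
      rcases le_or_gt (pos i) w with hiw | hiw
      · exact mul_nonneg_of_nonpos_of_nonpos (sub_nonpos.2 (hle _ _ (by omega)))
          (sub_nonpos.2 (hle _ _ (by rcases hb with hb | ⟨rfl, -⟩ <;> omega)))
      · have := hlt i
        exact mul_nonneg (sub_nonneg.2 (hle _ _ (by omega)))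
          (sub_nonneg.2 (hle _ _ (by rcases hb with hb | ⟨rfl, -⟩ <;> omega)))
    · rw [eval_mul, eval_mul]
      have hwi := hge i hiF h1 h2
      rcases Nat.lt_or_ge (pos i) (w + 2) with hi2 | hi2
      · rcases hwi.lt_or_eq with hwi | hwi
        · have hb' : b = i := hinj (by
            have := hlt i
            rcases hb with hb | ⟨-, hb⟩ <;> omega)
          simp [hb']
        · have ha' : a = i := hinj (haw.trans hwi)
          simp [ha']
      · rw [hqz i hiF hi2 h2, mul_zero]

/-- If the interior condition fails, `m` quadratics cover the interior positions, and the two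
remaining degrees are spent on minus the product of the linear factors at the first and last
parameters, which is nonnegative between them. -/
theorem exists_polynomial_of_not_isCyclicNonface (hinj : Function.Injective pos)
    (hlt : ∀ i, pos i < v) (hpos : ∀ i j, pos i < pos j → t i < t j)
    (hv : ∀ n < v, ∃ j, pos j = n) {m : ℕ} (hm : 2 * (m + 1) + 1 ≤ v) {F : Set (Fin v)}
    (h : ¬ IsCyclicNonface v (m + 1) (pos '' F)) :
    ∃ q : ℝ[X], q ≠ 0 ∧ q.natDegree ≤ 2 * (m + 1) ∧ (∀ i, 0 ≤ q.eval (t i)) ∧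
      ∀ i ∈ F, q.eval (t i) = 0 := by
  rcases not_and_or.1 h with h | h
  · obtain ⟨q, h0, hd, hn, hz⟩ := exists_polynomial_of_not_hasSeparated hinj hlt hpos hv _ _ h
    exact ⟨q, h0, hd, hn, fun i hi => hz i hi (Nat.zero_le _) (hlt i)⟩
  · obtain ⟨q, h0, hd, hn, hz⟩ := exists_polynomial_of_not_hasSeparated hinj hlt hpos hv _ _ h
    obtain ⟨a, ha⟩ := hv 0 (by omega)
    obtain ⟨b, hb⟩ := hv (v - 1) (by omega)
    have hle : ∀ i j, pos i ≤ pos j → t i ≤ t j := fun i j hij =>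
      hij.lt_or_eq.elim (fun h => (hpos i j h).le) fun h => (congrArg t (hinj h)).le
    refine ⟨-((X - C (t a)) * (X - C (t b))) * q, ?_, ?_, fun i => ?_, fun i hiF => ?_⟩
    · exact mul_ne_zero (neg_ne_zero.2 (mul_ne_zero (X_sub_C_ne_zero _) (X_sub_C_ne_zero _))) h0
    · refine natDegree_mul_le.trans ?_
      have := natDegree_mul_le (p := X - C (t a)) (q := X - C (t b))
      rw [natDegree_X_sub_C, natDegree_X_sub_C] at this
      rw [natDegree_neg]
      omega
    · rw [eval_mul, eval_neg, eval_mul]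
      refine mul_nonneg (neg_nonneg.2 ?_) (hn i)
      simp only [eval_sub, eval_X, eval_C]
      have := hlt i
      exact mul_nonpos_of_nonneg_of_nonpos (sub_nonneg.2 (hle _ _ (by omega)))
        (sub_nonpos.2 (hle _ _ (by omega)))
    · rw [eval_mul, eval_neg, eval_mul]
      by_cases h1 : pos i = 0
      · have : a = i := hinj (ha.trans h1.symm)
        simp [this]
      by_cases h2 : pos i = v - 1
      · have : b = i := hinj (hb.trans h2.symm)
        simp [this]
      · have := hlt i
        rw [hz i hiF (by omega) (by omega), mul_zero]

theorem eval_eq_add_sum {d : ℕ} {q : ℝ[X]} (hq : q.natDegree ≤ d) (x : ℝ) :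
    q.eval x = q.coeff 0 + ∑ k : Fin d, q.coeff (k + 1) * momentCurve d x k := by
  rw [eval_eq_sum_range' (Nat.lt_succ_iff.2 hq), Finset.sum_range_succ', Finset.sum_range, pow_zero,
    mul_one, add_comm]
  rfl

/-- A nonempty set of vertices of a cyclic polytope lies in a proper face exactly when some nonzero
polynomial of degree at most `d` is nonnegative at all parameters and vanishes on the set. -/
theorem mem_faces_cyclicBoundaryComplex_iff (ht : Function.Injective t) {d : ℕ} (hd : d < v)
    {F : Finset (Fin v)} (hF : F.Nonempty) :
    F ∈ (cyclicBoundaryComplex d t).faces ↔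
      ∃ q : ℝ[X], q ≠ 0 ∧ q.natDegree ≤ d ∧ (∀ i, 0 ≤ q.eval (t i)) ∧
        ∀ i ∈ F, q.eval (t i) = 0 := by
  have hmem : ∀ i, momentCurve d (t i) ∈ polytope fun i => momentCurve d (t i) :=
    fun i => subset_convexHull ℝ _ ⟨i, rfl⟩
  obtain ⟨i₀, hi₀⟩ := hF
  constructor
  · rintro ⟨-, Φ, ⟨hexp, hne⟩, hFΦ⟩
    obtain ⟨l, rfl⟩ := hexp ⟨_, hFΦ i₀ hi₀⟩
    let M := l (momentCurve d (t i₀))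
    -- Along the moment curve this is the gap between `l` and its maximum `M`.
    let q : ℝ[X] := C M - ∑ k : Fin d, C (l (Pi.single k 1)) * X ^ ((k : ℕ) + 1)
    have hqe : ∀ x, q.eval x = M - l (momentCurve d x) := fun x => by
      have hl := congrArg l (pi_eq_sum_univ' (momentCurve d x))
      rw [map_sum] at hl
      simp only [q, eval_sub, eval_C, eval_finsetSum, eval_mul, eval_pow, eval_X]
      rw [hl]
      refine congrArg (M - ·) (Finset.sum_congr rfl fun k _ => ?_)
      rw [map_smul, smul_eq_mul, mul_comm]
      congr 2
    refine ⟨q, fun hq0 => hne ?_, ?_, fun i => ?_, fun i hi => ?_⟩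
    · have hall : ∀ y ∈ polytope fun i => momentCurve d (t i), l y = M := fun y hy => by
        have hsub : polytope (fun i => momentCurve d (t i)) ⊆ {y | l y = M} :=
          convexHull_min (by
            rintro _ ⟨i, rfl⟩
            have := hqe (t i)
            rw [hq0, eval_zero] at this
            exact (sub_eq_zero.1 this.symm).symm) (convex_hyperplane l.toLinearMap.isLinear M)
        exact hsub hy
      exact Set.Subset.antisymm (Set.sep_subset _ _)
        fun y hy => ⟨hy, fun z hz => (hall z hz).le.trans (hall y hy).ge⟩
    · refine (natDegree_sub_le _ _).trans (max_le (by simp) ?_)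
      refine natDegree_sum_le_of_forall_le _ _ fun k _ => ?_
      exact (natDegree_C_mul_X_pow_le _ _).trans k.2
    · rw [hqe, sub_nonneg]
      exact (hFΦ i₀ hi₀).2 _ (hmem i)
    · rw [hqe, sub_eq_zero]
      exact le_antisymm ((hFΦ i hi).2 _ (hmem i₀)) ((hFΦ i₀ hi₀).2 _ (hmem i))
  · rintro ⟨q, hq0, hqd, hqn, hqz⟩
    -- The sign is reversed because exposed faces maximise `l`; the maximum is `q.coeff 0`, attained
    -- where `q` vanishes.
    let l : (Fin d → ℝ) →L[ℝ] ℝ :=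
      -∑ k : Fin d, q.coeff (k + 1) • ContinuousLinearMap.proj (R := ℝ) (φ := fun _ => ℝ) k
    have hl : ∀ x, l (momentCurve d x) = q.coeff 0 - q.eval x := fun x => by
      rw [eval_eq_add_sum hqd]
      simp [l]
    have hle : ∀ y ∈ polytope fun i => momentCurve d (t i), l y ≤ q.coeff 0 := fun y hy => by
      have hsub : polytope (fun i => momentCurve d (t i)) ⊆ {y | l y ≤ q.coeff 0} :=
        convexHull_min (by
          rintro _ ⟨i, rfl⟩
          change l _ ≤ _
          rw [hl]
          exact sub_le_self _ (hqn i)) (convex_halfSpace_le l.toLinearMap.isLinear _)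
      exact hsub hy
    refine ⟨⟨i₀, hi₀⟩, {x ∈ polytope fun i => momentCurve d (t i) |
      ∀ y ∈ polytope fun i => momentCurve d (t i), l y ≤ l x}, ⟨fun _ => ⟨l, rfl⟩, fun heq => ?_⟩,
      fun i hi => ⟨hmem i, fun y hy => ?_⟩⟩
    -- If the face were the whole polytope, `q` would have `v > d` roots.
    · refine hq0 (eq_zero_of_natDegree_lt_card_of_eval_eq_zero q ht (fun i => ?_)
        (by rw [Fintype.card_fin]; omega))
      have h1 := (heq.ge (hmem i)).2 _ (hmem i₀)
      rw [hl, hl, hqz i₀ hi₀, sub_zero] at h1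
      exact le_antisymm (by linarith) (hqn i)
    · rw [hl, hqz i hi, sub_zero]
      exact hle y hy

theorem notMem_faces_cyclicBoundaryComplex_iff (hinj : Function.Injective pos)
    (hlt : ∀ i, pos i < v) (hpos : ∀ i j, pos i < pos j → t i < t j)
    (hv : ∀ n < v, ∃ j, pos j = n) (ht : Function.Injective t) {m : ℕ} (hm : 2 * (m + 1) + 1 ≤ v)
    {F : Finset (Fin v)} (hF : F.Nonempty) :
    F ∉ (cyclicBoundaryComplex (2 * (m + 1)) t).faces ↔
      IsCyclicNonface v (m + 1) (pos '' (F : Set (Fin v))) := by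
  rw [mem_faces_cyclicBoundaryComplex_iff ht (by omega) hF]
  constructor
  · intro h
    by_contra hcon
    exact h (exists_polynomial_of_not_isCyclicNonface hinj hlt hpos hv hm hcon)
  · rintro h ⟨q, hq0, hqd, hqn, hqz⟩
    exact hq0 (eq_zero_of_isCyclicNonface hinj hlt hpos hv ht hm hqd hqn hqz h)

theorem stanleyReisnerIdeal_eq_cyclicIdeal (K : Type u) [Field K] (hinj : Function.Injective pos)
    (hlt : ∀ i, pos i < v) (hpos : ∀ i j, pos i < pos j → t i < t j)
    (hv : ∀ n < v, ∃ j, pos j = n) (ht : Function.Injective t) {m : ℕ}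
    (hm : 2 * (m + 1) + 1 ≤ v) :
    stanleyReisnerIdeal K (cyclicBoundaryComplex (2 * (m + 1)) t) =
      cyclicIdeal K pos v (m + 1) := by
  classical
  have hprod : ∀ F : Finset (Fin v), (∏ i ∈ F, MvPolynomial.X i : MvPolynomial (Fin v) K) =
      MvPolynomial.monomial (∑ i ∈ F, Finsupp.single i 1) 1 := fun F => by
    rw [MvPolynomial.monomial_sum_one]; rfl
  have happ : ∀ (F : Finset (Fin v)) i,
      (∑ j ∈ F, Finsupp.single j 1 : Fin v →₀ ℕ) i = if i ∈ F then 1 else 0 := fun F i => by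
    simp [Finsupp.finsetSum_apply, Finsupp.single_apply]
  apply le_antisymm
  · refine Ideal.span_le.2 ?_
    rintro _ ⟨F, hF, hFn, rfl⟩
    rw [hprod]
    refine monomial_mem_supportIdeal ?_ _
    have hsupp : (∑ i ∈ F, Finsupp.single i 1 : Fin v →₀ ℕ).support = F := by
      ext i; simp [happ]
    rw [hsupp]
    exact (notMem_faces_cyclicBoundaryComplex_iff hinj hlt hpos hv ht hm hF).1 hFn
  · intro f hf
    refine mem_of_monomials_mem fun n hn => ?_
    have hU := mem_supportIdeal.1 hf n hn
    have hne : n.support.Nonempty := by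
      obtain ⟨f, hf, -⟩ := hU.1
      obtain ⟨i, hi, -⟩ := (hf 0 (by omega)).2.2
      exact ⟨i, hi⟩
    refine Ideal.mem_of_dvd _ ?_ (Ideal.subset_span ⟨n.support, hne,
      (notMem_faces_cyclicBoundaryComplex_iff hinj hlt hpos hv ht hm hne).2 hU, rfl⟩)
    rw [hprod, MvPolynomial.monomial_dvd_monomial]
    refine ⟨Or.inr fun i => ?_, one_dvd _⟩
    rw [happ]
    split_ifs with hi
    · exact Nat.one_le_iff_ne_zero.2 (Finsupp.mem_support_iff.1 hi)
    · exact Nat.zero_le _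

theorem isBettiSequence_cyclicIdeal (K : Type u) [Field K] (hinj : Function.Injective pos)
    (hv : ∀ n < v, ∃ j, pos j = n) (m p : ℕ) (hp : 2 * m + 1 + p = v) :
    IsBettiSequence (cyclicIdeal K pos v m) fun i : Fin (p + 1) => cyclicBetti m p i := by
  let P : ProjectiveResolution (ModuleCat.of (MvPolynomial (Fin v) K)
    (MvPolynomial (Fin v) K ⧸ variablesIdeal K (Fin v))) := projectiveResolution _
  obtain ⟨hb, hpd⟩ := cyclicIdeal_resolution P hinj hv m p hp.le
  rw [hp] at hb hpd
  have hle := (projectiveDimension_le_iff _ p).2 hpd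
  refine ⟨le_antisymm hle ?_, fun i => ?_⟩
  -- A smaller projective dimension would kill Tor in degree `p`, where the Betti number is
  -- positive.
  · refine (projectiveDimension_ge_iff _ p).2 fun hlt => ?_
    have := tensorHomology_subsingleton_of_hasProjectiveDimensionLT P p
      (ModuleCat.of (MvPolynomial (Fin v) K) (cyclicIdeal K pos v m)) p le_rfl
    have hs : Subsingleton ((ModuleCat.restrictScalars (algebraMap K _)).obj
      ((tensorHomology P.complex p).obj (ModuleCat.of _ (cyclicIdeal K pos v m)))) := this
    have h0 := (hb p).2
    rw [Module.finrank_zero_of_subsingleton] at h0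
    exact (cyclicBetti_self_pos m p).ne h0
  · exact (hb i).2.symm.trans (((ModuleCat.restrictScalars (algebraMap K _)).mapIso
      (torIsoTensorHomology P _ i)).toLinearEquiv.finrank_eq).symm

end CyclicPolytope
-- The theorem.
theorem mainTheorem4 (K : Type u) [Field K] (v d : ℕ) (hd : 1 ≤ d) (hvd : d < v) (heven : Even d)
    (t : Fin v → ℝ) (ht : Function.Injective t) :
    ∃ (p : ℕ) (β : Fin (p + 1) → ℕ),
      IsBettiSequence (stanleyReisnerIdeal K (cyclicBoundaryComplex d t)) β ∧
        ∃ (n : ℕ) (Γ : PreAbstractSimplicialComplex (Fin n)), IsFVector Γ β := by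
  obtain ⟨m, rfl⟩ : ∃ m, d = 2 * (m + 1) := by
    obtain ⟨r, rfl⟩ := heven
    exact ⟨r - 1, by omega⟩
  -- The parameters come in arbitrary order; sorting them makes `pos i` the rank of `t i`.
  let σ := Tuple.sort t
  have hσ : StrictMono (t ∘ σ) := (Tuple.monotone_sort t).strictMono_of_injective
    (ht.comp σ.injective)
  let pos : Fin v → ℕ := fun i => (σ.symm i : ℕ)
  have hinj : Function.Injective pos := Fin.val_injective.comp σ.symm.injective
  have hlt : ∀ i, pos i < v := fun i => (σ.symm i).2
  have hpos : ∀ i j, pos i < pos j → t i < t j := fun i j hij => by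
    have := hσ (Fin.lt_def.2 hij)
    simpa using this
  have hv : ∀ n < v, ∃ j, pos j = n := fun n hn => ⟨σ ⟨n, hn⟩, by simp [pos]⟩
  rw [stanleyReisnerIdeal_eq_cyclicIdeal K hinj hlt hpos hv ht (by omega)]
  exact ⟨v - (2 * (m + 1) + 1), _,
    isBettiSequence_cyclicIdeal K hinj hv (m + 1) _ (by omega), exists_isFVector_cyclicBetti m _⟩
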